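/- Let $0<v_{\min}<v_{\max}<\infty$ and let $p_-,p_+:\mathbb R\to[0,\infty)$ be even, integrable, of positive integral, with $p_\pm(v)=0$ whenever $|v|\le v_{\min}$ or $|v|\ge v_{\max}$ (velocity cutoff). For $k\ge 0$ put $$F_k^-=\int_{v_{\min}}^{v_{\max}}v^kp_-(v)\,dv,\qquad F_k^+=\int_{-v_{\max}}^{-v_{\min}}v^kp_+(v)\,dv,\qquad Q_k=F_k^--F_k^+ ,$$ and assume mechanical equilibrium, $Q_2=0$. Fix $\bar V\in(0,v_{\min}/3)$. A piston of mass $M$ starts at the origin of the real line with velocity $u\in[-\bar V,\bar V]$, in a gas of non-interacting atoms of mass $m$ whose initial positions and velocities $(x,v)$ form a Poisson process on $\mathbb R^2$ with density $p_-(v)$ for $x<0$ and $p_+(v)$ for $x>0$. Between collisions the piston and the atoms move with constant velocities. When the piston, with velocity $V$, meets an atom, with velocity $v$, the velocity of the atom becomes $-\frac{M-m}{M+m}v+\frac{2M}{M+m}V$; with $V'=\frac{M-m}{M+m}V+\frac{2m}{M+m}v$, the velocity of the piston becomes $V'$ if $|V'|\le\bar V$, $2\bar V-V'$ if $V'>\bar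 V$, and $-2\bar V-V'$ if $V'<-\bar V$. Let $W(t)$ be the velocity of the piston at time $t$ and $\mathcal P(u,dw;t)$ the law of $W(t)$ given $W(0)=u$. Let $\mu_0$ be a stationary measure of $W$, i.e. a probability measure on $[-\bar V,\bar V]$ with $\int\mathcal P(u,\cdot\,;t)\,d\mu_0(u)=\mu_0$ for all $t\ge0$. Write $\langle W^k\rangle=\int w^k\,d\mu_0(w)$ and $\varepsilon=m/M$. Then there are constants $C,c,\varepsilon_0>0$, depending only on $v_{\min},v_{\max},\bar V,p_-,p_+$, such that for all $m,M>0$ with $\varepsilon\le\varepsilon_0$ and every such $\mu_0$ $$\Big|\langle W^2\rangle-\frac{Q_3}{2Q_1}\,\varepsilon\Big|\le C\varepsilon^2,\qquad \Big|\langle W\rangle-\frac{Q_0Q_3}{4Q_1^2}\,\varepsilon\Big|\le C\varepsilon^2 .$$ Moreover the first and second moment identities hold up to an exponentially small effect of the reflection: $$\big|Q_2-2Q_1\langle W\rangle+Q_0\langle W^2\rangle\big|\le Ce^{-c/\varepsilon},$$ $$\Big|2Q_1\langle W^2\rangle-Q_0\langle W^3\rangle-\frac{m}{M+m}\big(Q_3+3Q_1\langle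 W^2\rangle-Q_0\langle W^3\rangle\big)\Big|\le Ce^{-c/\varepsilon}.$$ -/

import Mathlib

open MeasureTheory ProbabilityTheory Filter Topology Set
open scoped ENNReal NNReal

noncomputable section

namespace Piston

/-! ### The gases -/

/-- `p = n f` with `n > 0` and `f` an even probability density, subject to the velocity cutoff. -/
structure IsGasDensity (vmin vmax : ℝ) (p : ℝ → ℝ) : Prop where
  measurable : Measurable p
  nonneg : ∀ v, 0 ≤ p v
  even : ∀ v, p (-v) = p v
  integrable : Integrable p
  pos : 0 < ∫ v, p v
  cutoff : ∀ v, |v| ≤ vmin ∨ vmax ≤ |v| → p v = 0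

/-- `F_k^-`, the one-sided moments of the left gas. -/
def Fminus (vmin vmax : ℝ) (pminus : ℝ → ℝ) (k : ℕ) : ℝ :=
  ∫ v in vmin..vmax, v ^ k * pminus v

/-- `F_k^+`, the one-sided moments of the right gas. -/
def Fplus (vmin vmax : ℝ) (pplus : ℝ → ℝ) (k : ℕ) : ℝ :=
  ∫ v in (-vmax)..(-vmin), v ^ k * pplus v

/-- `Q_k = F_k^- - F_k^+`. -/
def Q (vmin vmax : ℝ) (pminus pplus : ℝ → ℝ) (k : ℕ) : ℝ :=
  Fminus vmin vmax pminus k - Fplus vmin vmax pplus k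

/-- The measure `p(x,v) dx dv` on the `(x,v)`-plane, with `p(x,v) = p_-(v)` for `x < 0` and
`p(x,v) = p_+(v)` for `x > 0`. -/
def gasIntensity (pminus pplus : ℝ → ℝ) : Measure (ℝ × ℝ) :=
  volume.withDensity fun a => ENNReal.ofReal (if a.1 < 0 then pminus a.2 else pplus a.2)

/-- The random set of points `ξ` is a Poisson process with intensity measure `ν`: the number of
points in `D` is Poisson with parameter `ν D`, and the numbers of points in disjoint sets are
independent. -/
structure IsPoissonProcess {Ω E : Type*} [MeasurableSpace Ω] [MeasurableSpace E]
    (P : Measure Ω) (ξ : Ω → Set E) (ν : Measure E) : Prop where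
  measurable_count : ∀ D, MeasurableSet D → Measurable fun ω => (ξ ω ∩ D).encard
  count_law : ∀ D, MeasurableSet D → ν D ≠ ∞ → ∀ k : ℕ,
    P {ω | (ξ ω ∩ D).encard = k} = poissonMeasure (ν D).toNNReal {k}
  indep : ∀ (n : ℕ) (D : Fin n → Set E), (∀ i, MeasurableSet (D i)) →
    Pairwise (Function.onFun Disjoint D) → iIndepFun (fun i ω => (ξ ω ∩ D i).encard) P

/-! ### The mechanics -/

/-- Velocity of the piston after an elastic collision. -/
def pistonAfter (m M V v : ℝ) : ℝ := (M - m) / (M + m) * V + 2 * m / (M + m) * v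

/-- Velocity of the atom after an elastic collision. -/
def atomAfter (m M V v : ℝ) : ℝ := -((M - m) / (M + m)) * v + 2 * M / (M + m) * V

/-- Reflection of the piston velocity at `±Vbar`. -/
def reflect (Vbar V : ℝ) : ℝ :=
  if Vbar < V then 2 * Vbar - V else if V < -Vbar then -2 * Vbar - V else V

/-- `f` has the constant value `c` immediately before time `t`. -/
def JustBefore (f : ℝ → ℝ) (t c : ℝ) : Prop := ∀ᶠ s in 𝓝[<] t, f s = c

/-- On `[0, ∞)`, `f` is a right-continuous step function with locally finitely many jumps. -/
structure IsStep (f : ℝ → ℝ) : Prop where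
  right : ∀ t, 0 ≤ t → ∀ᶠ s in 𝓝[>] t, f s = f t
  left : ∀ t, 0 < t → ∃ c, JustBefore f t c

/-- The evolution, for times `t ≥ 0`, of a piston (position `X`, velocity `W`, started at the origin
with velocity `u`) and of the atoms, with the reflection rule for the piston velocity. The set `A`
consists of the initial positions and velocities of the atoms; the atom that starts from `a ∈ A`
has position `y a` and velocity `w a`. Atoms do not interact with each other. -/
structure Evolution (m M Vbar u : ℝ) (A : Set (ℝ × ℝ)) (X W : ℝ → ℝ)
    (y w : ℝ × ℝ → ℝ → ℝ) : Prop where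
  piston_start : W 0 = u
  atom_start : ∀ a ∈ A, w a 0 = a.2
  piston_step : IsStep W
  atom_step : ∀ a ∈ A, IsStep (w a)
  piston_position : ∀ t, 0 ≤ t → X t = ∫ s in (0 : ℝ)..t, W s
  atom_position : ∀ a ∈ A, ∀ t, 0 ≤ t → y a t = a.1 + ∫ s in (0 : ℝ)..t, w a s
  single : ∀ t, 0 < t → ∀ a ∈ A, ∀ b ∈ A, y a t = X t → y b t = X t → a = b
  piston_free : ∀ t, 0 < t → (∀ a ∈ A, y a t ≠ X t) → JustBefore W t (W t)
  atom_free : ∀ a ∈ A, ∀ t, 0 < t → y a t ≠ X t → JustBefore (w a) t (w a t)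
  collision : ∀ a ∈ A, ∀ t, 0 < t → y a t = X t → ∀ V v, JustBefore W t V →
    JustBefore (w a) t v →
      W t = reflect Vbar (pistonAfter m M V v) ∧ w a t = atomAfter m M V v

/-! ### The velocity process and its stationary measures -/

/-- `κ t u` is, for `t ≥ 0` and `u ∈ [-Vbar, Vbar]`, the transition probability of the velocity
process `W`: the law of `W t` when `W 0 = u` and the piston moves in a Poisson gas. -/
def IsTransitionProbability (m M Vbar : ℝ) (pminus pplus : ℝ → ℝ) (κ : ℝ → Kernel ℝ ℝ) : Prop :=
  ∀ u ∈ Icc (-Vbar) Vbar,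
    ∃ (Ω : Type) (_ : MeasurableSpace Ω) (P : Measure Ω) (ξ : Ω → Set (ℝ × ℝ)) (W : ℝ → Ω → ℝ),
      IsProbabilityMeasure P ∧
      IsPoissonProcess P ξ (gasIntensity pminus pplus) ∧
      (∀ t, 0 ≤ t → AEMeasurable (W t) P) ∧
      (∀ᵐ ω ∂P, ∃ (X : ℝ → ℝ) (y w : ℝ × ℝ → ℝ → ℝ),
        Evolution m M Vbar u (ξ ω) X (fun t => W t ω) y w) ∧
      ∀ t, 0 ≤ t → κ t u = P.map (W t)

/-- `μ` is a stationary probability measure, on `[-Vbar, Vbar]`, of the velocity process `W`. -/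
structure IsStationary (m M Vbar : ℝ) (pminus pplus : ℝ → ℝ) (μ : Measure ℝ) : Prop where
  prob : IsProbabilityMeasure μ
  support : ∀ᵐ u ∂μ, u ∈ Icc (-Vbar) Vbar
  invariant : ∃ κ : ℝ → Kernel ℝ ℝ, IsTransitionProbability m M Vbar pminus pplus κ ∧
    ∀ t, 0 ≤ t → μ.bind (κ t) = μ

end Piston

end

/-!
Up to probability `O(h²)` the piston meets at most one atom during `[0, h]`, so a stationary
measure annihilates the generator `L f u = ∫ v, (v - u) * g v * (f u' - f u)`, where `g` is `pminus`
on the right half-line and `-pplus` on the left one, and `u'` is the reflection of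
`u + η * (v - u)`, `η = 2 * m / (M + m)`.

Since `Q 2 = 0` the drift is `-2 * Q 1 * η * u` to leading order, against jumps of size `O(η)`.
Hence `exp (a * u ^ 2 / η)` is a Lyapunov function for small `a`, its mean is bounded as `η → 0`,
and the reflection, which acts only where `Vbar / 2 < |u|`, contributes `O(exp (-c / η))`. Without
the reflection `L` maps polynomials to polynomials: testing with `w`, `w ^ 2`, `w ^ 3` gives three
moment equations. The third one yields `⟨W³⟩ = O(η²)`, then the second one `⟨W²⟩`, and the first
one `⟨W⟩`.
-/

namespace Piston

/-! ### Mechanics up to the first collision -/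

lemma IsStep.eq_const_of_free {f : ℝ → ℝ} (hf : IsStep f) {s T c : ℝ} (hs : 0 ≤ s) (h0 : f s = c)
    (h : ∀ t, s < t → t ≤ T → (∀ r ∈ Ico s t, f r = c) → JustBefore f t (f t)) :
    ∀ t ∈ Icc s T, f t = c := by
  by_contra! hcon
  obtain ⟨t₀, ht₀, hne⟩ := hcon
  let B : Set ℝ := {t | t ∈ Icc s T ∧ f t ≠ c}
  have hBne : B.Nonempty := ⟨t₀, ht₀, hne⟩
  have hBbd : BddBelow B := ⟨s, fun t ht => ht.1.1⟩
  have hsb : s ≤ sInf B := le_csInf hBne fun t ht => ht.1.1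
  have hbT : sInf B ≤ T := (csInf_le hBbd ⟨ht₀, hne⟩).trans ht₀.2
  have hbelow : ∀ r ∈ Ico s (sInf B), f r = c := by
    intro r hr
    by_contra hrc
    exact absurd (csInf_le hBbd ⟨⟨hr.1, hr.2.le.trans hbT⟩, hrc⟩) (not_le.2 hr.2)
  have hat : f (sInf B) = c := by
    rcases hsb.eq_or_lt with heq | hlt
    · rw [← heq, h0]
    · have hIoo : ∀ᶠ r in 𝓝[<] sInf B, r ∈ Ioo s (sInf B) := Ioo_mem_nhdsLT hlt
      obtain ⟨r, hr, hr'⟩ := ((h _ hlt hbT hbelow).and hIoo).exists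
      rw [← hr, hbelow r ⟨hr'.1.le, hr'.2⟩]
  obtain ⟨d, hd, hdsub⟩ := mem_nhdsGT_iff_exists_Ioo_subset.1 (hf.right _ (hs.trans hsb))
  refine absurd hd (not_lt.2 (le_csInf hBne fun t ht => ?_))
  by_contra! htd
  rcases (csInf_le hBbd ht).eq_or_lt with heq | hlt
  · exact ht.2 (heq ▸ hat)
  · exact ht.2 ((hdsub ⟨hlt, htd⟩ : f t = f (sInf B)).trans hat)

lemma ae_restrict_Ioc_eq_const {f : ℝ → ℝ} {s t c : ℝ} (h : ∀ r ∈ Ico s t, f r = c) :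
    f =ᵐ[volume.restrict (Ioc s t)] fun _ => c := by
  rw [← restrict_Ico_eq_restrict_Ioc]
  exact (ae_restrict_iff' measurableSet_Ico).2 (.of_forall h)

lemma intervalIntegrable_of_eqOn_Ico {f : ℝ → ℝ} {s t c : ℝ} (hst : s ≤ t)
    (h : ∀ r ∈ Ico s t, f r = c) : IntervalIntegrable f volume s t := by
  rw [intervalIntegrable_iff_integrableOn_Ioc_of_le hst]
  exact (integrableOn_const (by simp) (by simp)).congr (ae_restrict_Ioc_eq_const h).symm

lemma integral_eq_of_eqOn_Ico {f : ℝ → ℝ} {s t c : ℝ} (hst : s ≤ t)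
    (h : ∀ r ∈ Ico s t, f r = c) : ∫ r in s..t, f r = c * (t - s) := by
  rw [intervalIntegral.integral_of_le hst, integral_congr_ae (ae_restrict_Ioc_eq_const h),
    ← intervalIntegral.integral_of_le hst, intervalIntegral.integral_const, smul_eq_mul, mul_comm]

lemma integral_eq_of_eqOn_Ico_of_eqOn_Ico {f : ℝ → ℝ} {r s t c d : ℝ} (hrs : r ≤ s) (hst : s ≤ t)
    (h : ∀ q ∈ Ico r s, f q = c) (h' : ∀ q ∈ Ico s t, f q = d) :
    ∫ q in r..t, f q = c * (s - r) + d * (t - s) := by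
  rw [← intervalIntegral.integral_add_adjacent_intervals (intervalIntegrable_of_eqOn_Ico hrs h)
    (intervalIntegrable_of_eqOn_Ico hst h'), integral_eq_of_eqOn_Ico hrs h,
    integral_eq_of_eqOn_Ico hst h']

lemma mul_lt_abs_add_mul {vmax Vbar T t : ℝ} {b : ℝ × ℝ} (hVbar : 0 ≤ Vbar) (hb : |b.2| ≤ vmax)
    (hfar : (vmax + Vbar) * T < |b.1|) (ht : t ∈ Icc 0 T) : Vbar * t < |b.1 + b.2 * t| := by
  have hsub : |b.1| - |b.2| * t ≤ |b.1 + b.2 * t| := by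
    simpa [abs_mul, abs_of_nonneg ht.1] using abs_sub_abs_le_abs_sub b.1 (-(b.2 * t))
  have hvmax : 0 ≤ vmax + Vbar := by linarith [abs_nonneg b.2]
  linarith [mul_le_mul_of_nonneg_right hb ht.1, mul_le_mul_of_nonneg_left ht.2 hvmax]

lemma eq_of_add_mul_eq {a : ℝ × ℝ} {u s t : ℝ} (hau : a.2 ≠ u) (hs : a.1 + a.2 * s = u * s)
    (ht : a.1 + a.2 * t = u * t) : s = t := by
  have : (a.2 - u) * (s - t) = 0 := by linear_combination hs - ht
  exact sub_eq_zero.1 ((mul_eq_zero.1 this).resolve_left (sub_ne_zero.2 hau))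

lemma ne_mul_of_mul_lt_abs {Vbar u t x : ℝ} (hu : |u| ≤ Vbar) (ht : 0 ≤ t)
    (hx : Vbar * t < |x|) : x ≠ u * t := by
  rintro rfl
  rw [abs_mul, abs_of_nonneg ht] at hx
  exact hx.not_ge (mul_le_mul_of_nonneg_right hu ht)

namespace Evolution

variable {m M Vbar u : ℝ} {A : Set (ℝ × ℝ)} {X W : ℝ → ℝ} {y w : ℝ × ℝ → ℝ → ℝ}

lemma piston_position_of_eqOn_Ico (E : Evolution m M Vbar u A X W y w) {t : ℝ} (ht : 0 ≤ t)
    (hW : ∀ r ∈ Ico 0 t, W r = u) : X t = u * t := by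
  rw [E.piston_position t ht, integral_eq_of_eqOn_Ico ht hW, sub_zero]

lemma atom_position_of_eqOn_Ico (E : Evolution m M Vbar u A X W y w) {a : ℝ × ℝ} (ha : a ∈ A)
    {t : ℝ} (ht : 0 ≤ t) (hw : ∀ r ∈ Ico 0 t, w a r = a.2) : y a t = a.1 + a.2 * t := by
  rw [E.atom_position a ha t ht, integral_eq_of_eqOn_Ico ht hw, sub_zero]

lemma abs_piston_position_le (E : Evolution m M Vbar u A X W y w) {t B : ℝ} (ht : 0 ≤ t)
    (hW : ∀ r ∈ Ico 0 t, |W r| ≤ B) : |X t| ≤ B * t := by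
  have hae : ∀ᵐ r, r ∈ uIoc 0 t → ‖W r‖ ≤ B := by
    filter_upwards [volume.ae_ne t] with r hrt hr
    rw [uIoc_of_le ht] at hr
    exact hW r ⟨hr.1.le, hr.2.lt_of_ne hrt⟩
  simpa [← E.piston_position t ht, abs_of_nonneg ht] using
    intervalIntegral.norm_integral_le_of_norm_le_const_ae hae

lemma atom_free_flight (E : Evolution m M Vbar u A X W y w) {a : ℝ × ℝ} (ha : a ∈ A) {T : ℝ}
    (h : ∀ t ∈ Ioc 0 T, a.1 + a.2 * t ≠ X t) :
    ∀ t ∈ Icc 0 T, w a t = a.2 ∧ y a t = a.1 + a.2 * t := by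
  have hw : ∀ t ∈ Icc 0 T, w a t = a.2 :=
    (E.atom_step a ha).eq_const_of_free le_rfl (E.atom_start a ha) fun t ht htT hr =>
      E.atom_free a ha t ht (by
        rw [E.atom_position_of_eqOn_Ico ha ht.le hr]
        exact h t ⟨ht, htT⟩)
  exact fun t ht => ⟨hw t ht, E.atom_position_of_eqOn_Ico ha ht.1 fun r hr =>
    hw r ⟨hr.1, hr.2.le.trans ht.2⟩⟩

lemma piston_free_flight (E : Evolution m M Vbar u A X W y w) {T : ℝ}
    (h : ∀ a ∈ A, ∀ t ∈ Ioc 0 T, a.1 + a.2 * t ≠ u * t) : ∀ t ∈ Icc 0 T, W t = u := by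
  refine E.piston_step.eq_const_of_free le_rfl E.piston_start fun t ht htT hr => ?_
  refine E.piston_free t ht fun a ha => ?_
  have hmiss : ∀ s ∈ Ioc 0 t, a.1 + a.2 * s ≠ X s := fun s hs => by
    rw [E.piston_position_of_eqOn_Ico hs.1.le fun r hr' => hr r ⟨hr'.1, hr'.2.trans_le hs.2⟩]
    exact h a ha s ⟨hs.1, hs.2.trans htT⟩
  rw [(E.atom_free_flight ha hmiss t ⟨ht.le, le_rfl⟩).2]
  exact hmiss t ⟨ht, le_rfl⟩

lemma piston_free_flight_before (E : Evolution m M Vbar u A X W y w) {τ : ℝ}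
    (h : ∀ a ∈ A, ∀ t ∈ Ioo 0 τ, a.1 + a.2 * t ≠ u * t) : ∀ t ∈ Ico 0 τ, W t = u := fun t ht =>
  E.piston_free_flight (fun a ha s hs => h a ha s ⟨hs.1, hs.2.trans_lt ht.2⟩) t ⟨ht.1, le_rfl⟩

lemma atom_free_flight_before (E : Evolution m M Vbar u A X W y w) {τ : ℝ}
    (h : ∀ a ∈ A, ∀ t ∈ Ioo 0 τ, a.1 + a.2 * t ≠ u * t) {a : ℝ × ℝ} (ha : a ∈ A) :
    ∀ t ∈ Ico 0 τ, w a t = a.2 := fun t ht => by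
  refine (E.atom_free_flight ha (fun s hs => ?_) t ⟨ht.1, le_rfl⟩).1
  have hsτ : s < τ := hs.2.trans_lt ht.2
  rw [E.piston_position_of_eqOn_Ico hs.1.le fun r hr =>
    E.piston_free_flight_before h r ⟨hr.1, hr.2.trans hsτ⟩]
  exact h a ha s ⟨hs.1, hsτ⟩

lemma first_collision (E : Evolution m M Vbar u A X W y w) {τ : ℝ} {a : ℝ × ℝ} (hτ : 0 < τ)
    (h : ∀ b ∈ A, ∀ t ∈ Ioo 0 τ, b.1 + b.2 * t ≠ u * t) (ha : a ∈ A)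
    (hhit : a.1 + a.2 * τ = u * τ) :
    W τ = reflect Vbar (pistonAfter m M u a.2) ∧ w a τ = atomAfter m M u a.2 := by
  have hW := E.piston_free_flight_before h
  have hw := E.atom_free_flight_before h ha
  have hmeet : y a τ = X τ := by
    rw [E.atom_position_of_eqOn_Ico ha hτ.le hw, E.piston_position_of_eqOn_Ico hτ.le hW, hhit]
  have hIoo : ∀ᶠ s in 𝓝[<] τ, s ∈ Ioo 0 τ := Ioo_mem_nhdsLT hτ
  exact E.collision a ha τ hτ hmeet u a.2 (hIoo.mono fun s hs => hW s ⟨hs.1.le, hs.2⟩)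
    (hIoo.mono fun s hs => hw s ⟨hs.1.le, hs.2⟩)

lemma atom_ne_piston_after (E : Evolution m M Vbar u A X W y w) {τ t V' v' : ℝ} {a : ℝ × ℝ}
    (ha : a ∈ A) (hτ : 0 < τ) (hτt : τ < t) (hhit : a.1 + a.2 * τ = u * τ)
    (hW : ∀ r ∈ Ico 0 τ, W r = u) (hw : ∀ r ∈ Ico 0 τ, w a r = a.2)
    (hW' : ∀ r ∈ Ico τ t, W r = V') (hw' : w a τ = v') (hne : v' ≠ V') : y a t ≠ X t := by
  have hsep : ∀ s ∈ Ioc τ t, (∀ r ∈ Ico τ s, w a r = v') → y a s ≠ X s := by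
    intro s hs hr heq
    have hs0 : 0 ≤ s := hτ.le.trans hs.1.le
    rw [E.atom_position a ha s hs0, integral_eq_of_eqOn_Ico_of_eqOn_Ico hτ.le hs.1.le hw hr,
      E.piston_position s hs0, integral_eq_of_eqOn_Ico_of_eqOn_Ico hτ.le hs.1.le hW
        fun r hr' => hW' r ⟨hr'.1, hr'.2.trans_le hs.2⟩] at heq
    have : (v' - V') * (s - τ) = 0 := by linear_combination heq - hhit
    rcases mul_eq_zero.1 this with h | h
    · exact hne (sub_eq_zero.1 h)
    · exact hs.1.ne' (sub_eq_zero.1 h)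
  have hfree : ∀ s ∈ Icc τ t, w a s = v' :=
    (E.atom_step a ha).eq_const_of_free hτ.le hw' fun s hs hst hr =>
      E.atom_free a ha s (hτ.trans hs) (hsep s ⟨hs, hst⟩ hr)
  exact hsep t ⟨hτt, le_rfl⟩ fun r hr => hfree r ⟨hr.1, hr.2.le⟩

lemma piston_one_collision (E : Evolution m M Vbar u A X W y w) {T τ : ℝ} {a : ℝ × ℝ}
    (hu : |u| ≤ Vbar) (ha : a ∈ A) (hau : a.2 ≠ u) (hτ : τ ∈ Ioc 0 T)
    (hhit : a.1 + a.2 * τ = u * τ)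
    (hfar : ∀ b ∈ A, b ≠ a → ∀ t ∈ Ioc 0 T, Vbar * t < |b.1 + b.2 * t|)
    (hbd : |reflect Vbar (pistonAfter m M u a.2)| ≤ Vbar)
    (hsep : atomAfter m M u a.2 ≠ reflect Vbar (pistonAfter m M u a.2)) :
    W T = reflect Vbar (pistonAfter m M u a.2) := by
  have hbefore : ∀ b ∈ A, ∀ t ∈ Ioo 0 τ, b.1 + b.2 * t ≠ u * t := by
    intro b hb t ht heq
    rcases eq_or_ne b a with rfl | hba
    · exact ht.2.ne (eq_of_add_mul_eq hau heq hhit)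
    · exact ne_mul_of_mul_lt_abs hu ht.1.le (hfar b hb hba t ⟨ht.1, ht.2.le.trans hτ.2⟩) heq
  have hW := E.piston_free_flight_before hbefore
  obtain ⟨hWτ, hwτ⟩ := E.first_collision hτ.1 hbefore ha hhit
  refine E.piston_step.eq_const_of_free hτ.1.le (T := T) hWτ (fun t ht htT hr => ?_) T
    ⟨hτ.2, le_rfl⟩
  refine E.piston_free t (hτ.1.trans ht) fun b hb => ?_
  rcases eq_or_ne b a with rfl | hba
  · exact E.atom_ne_piston_after hb hτ.1 ht hhit hW (E.atom_free_flight_before hbefore hb) hr hwτ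
      hsep
  have hspeed : ∀ r ∈ Ico 0 t, |W r| ≤ Vbar := fun r hr' => by
    rcases lt_or_ge r τ with h | h
    · rwa [hW r ⟨hr'.1, h⟩]
    · rwa [hr r ⟨h, hr'.2⟩]
  have hmiss : ∀ s ∈ Ioc 0 t, b.1 + b.2 * s ≠ X s := fun s hs heq => by
    have hlt := hfar b hb hba s ⟨hs.1, hs.2.trans htT⟩
    rw [heq] at hlt
    exact hlt.not_ge (E.abs_piston_position_le hs.1.le fun r hr' =>
      hspeed r ⟨hr'.1, hr'.2.trans_le hs.2⟩)
  rw [(E.atom_free_flight hb hmiss t ⟨(hτ.1.trans ht).le, le_rfl⟩).2]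
  exact hmiss t ⟨hτ.1.trans ht, le_rfl⟩

end Evolution
/-! ### Expectations in a Poisson process of small intensity -/

/-- The unique point of `ξ ω` in `D`, with the junk value `default` unless there is exactly one. -/
noncomputable def uniquePoint {Ω E : Type*} [Inhabited E] (ξ : Ω → Set E) (D : Set E) (ω : Ω) : E :=
  open Classical in if h : ∃ a, ξ ω ∩ D = {a} then h.choose else default

lemma uniquePoint_eq {Ω E : Type*} [Inhabited E] {ξ : Ω → Set E} {D : Set E} {ω : Ω} {a : E}
    (h : ξ ω ∩ D = {a}) : uniquePoint ξ D ω = a := by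
  have hex : ∃ a, ξ ω ∩ D = {a} := ⟨a, h⟩
  rw [uniquePoint, dif_pos hex]
  exact (singleton_injective (h.symm.trans hex.choose_spec)).symm

lemma disjoint_count_zero_count_one {Ω E : Type*} (ξ : Ω → Set E) (D : Set E) :
    Disjoint {ω | (ξ ω ∩ D).encard = 0} {ω | (ξ ω ∩ D).encard = 1} :=
  Set.disjoint_left.2 fun _ h h' => zero_ne_one (h.symm.trans h')

lemma one_sub_exp_neg_mul_le_sq {l : ℝ} (hl : 0 ≤ l) :
    1 - Real.exp (-l) * (1 + l) ≤ l ^ 2 := by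
  have hexp : 1 - l ≤ Real.exp (-l) := by linarith [Real.add_one_le_exp (-l)]
  nlinarith [mul_le_mul_of_nonneg_right hexp (by linarith : 0 ≤ 1 + l)]

namespace IsPoissonProcess

variable {Ω E : Type*} [MeasurableSpace Ω] [MeasurableSpace E] {P : Measure Ω}
  {ξ : Ω → Set E} {ν : Measure E} {D : Set E}

lemma measurableSet_count_eq (hξ : IsPoissonProcess P ξ ν) (hD : MeasurableSet D) (k : ℕ∞) :
    MeasurableSet {ω | (ξ ω ∩ D).encard = k} :=
  hξ.measurable_count D hD (measurableSet_singleton k)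

lemma prob_count_zero (hξ : IsPoissonProcess P ξ ν) (hD : MeasurableSet D) (hν : ν D ≠ ∞) :
    P {ω | (ξ ω ∩ D).encard = 0} = ENNReal.ofReal (Real.exp (-(ν D).toReal)) := by
  have := hξ.count_law D hD hν 0
  rw [poissonMeasure_singleton] at this
  simpa [ENNReal.coe_toNNReal_eq_toReal] using this

lemma prob_count_one (hξ : IsPoissonProcess P ξ ν) (hD : MeasurableSet D) (hν : ν D ≠ ∞) :
    P {ω | (ξ ω ∩ D).encard = 1} = ENNReal.ofReal (Real.exp (-(ν D).toReal)) * ν D := by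
  have := hξ.count_law D hD hν 1
  rw [poissonMeasure_singleton] at this
  simp only [Nat.cast_one, pow_one, Nat.factorial_one, div_one] at this
  rw [this, ENNReal.ofReal_mul (Real.exp_pos _).le]
  simp [ENNReal.coe_toNNReal_eq_toReal, ENNReal.ofReal_toReal hν]

lemma ae_inter_eq_empty (hξ : IsPoissonProcess P ξ ν) [IsProbabilityMeasure P]
    (hD : MeasurableSet D) (hν : ν D = 0) : ∀ᵐ ω ∂P, ξ ω ∩ D = ∅ := by
  have h := hξ.prob_count_zero hD (by simp [hν])
  simp only [hν, ENNReal.toReal_zero, neg_zero, Real.exp_zero, ENNReal.ofReal_one] at h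
  filter_upwards [(mem_ae_iff_prob_eq_one (hξ.measurableSet_count_eq hD 0)).2 h] with ω hω
  exact encard_eq_zero.1 hω

lemma prob_count_one_count_zero (hξ : IsPoissonProcess P ξ ν) {A : Set E}
    (hD : MeasurableSet D) (hν : ν D ≠ ∞) (hA : MeasurableSet A) (hAD : A ⊆ D) :
    P {ω | (ξ ω ∩ A).encard = 1 ∧ (ξ ω ∩ (D \ A)).encard = 0} =
      ENNReal.ofReal (Real.exp (-(ν D).toReal)) * ν A := by
  have hνA : ν A ≠ ∞ := ne_top_of_le_ne_top hν (measure_mono hAD)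
  have hνDA : ν (D \ A) ≠ ∞ := ne_top_of_le_ne_top hν (measure_mono sdiff_subset)
  have hind := hξ.indep 2 ![A, D \ A] (by intro i; fin_cases i <;> simp [hA, hD.diff hA])
    (by
      intro i j hij
      fin_cases i <;> fin_cases j <;> simp_all [Function.onFun, disjoint_sdiff_left,
        disjoint_sdiff_right])
  have hind' : IndepFun (fun ω => (ξ ω ∩ A).encard) (fun ω => (ξ ω ∩ (D \ A)).encard) P := by
    simpa using hind.indepFun (i := 0) (j := 1) (by decide)
  have hmul : P {ω | (ξ ω ∩ A).encard = 1 ∧ (ξ ω ∩ (D \ A)).encard = 0} =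
      P {ω | (ξ ω ∩ A).encard = 1} * P {ω | (ξ ω ∩ (D \ A)).encard = 0} :=
    hind'.measure_inter_preimage_eq_mul {1} {0} (measurableSet_singleton _)
      (measurableSet_singleton _)
  rw [hmul, hξ.prob_count_one hA hνA, hξ.prob_count_zero (hD.diff hA) hνDA, mul_right_comm,
    ← ENNReal.ofReal_mul (Real.exp_pos _).le, ← Real.exp_add]
  congr 3
  rw [← measure_inter_add_sdiff D hA, inter_eq_right.2 hAD, ENNReal.toReal_add hνA hνDA]
  ring_nf

lemma measurable_uniquePoint [Inhabited E] (hξ : IsPoissonProcess P ξ ν)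
    (hD : MeasurableSet D) : Measurable (uniquePoint ξ D) := by
  intro A hA
  have h1 := hξ.measurableSet_count_eq hD 1
  have h2 := hξ.measurableSet_count_eq (hD.inter hA) 1
  have hpre : uniquePoint ξ D ⁻¹' A =
      ({ω | (ξ ω ∩ D).encard = 1} ∩ {ω | (ξ ω ∩ (D ∩ A)).encard = 1}) ∪
        ({ω | (ξ ω ∩ D).encard = 1}ᶜ ∩ {_ω | default ∈ A}) := by
    ext ω
    by_cases h : ∃ a, ξ ω ∩ D = {a}
    · obtain ⟨a, ha⟩ := h
      simp only [mem_preimage, uniquePoint_eq ha, mem_union, mem_inter_iff, mem_ofPred_eq,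
        mem_compl_iff, ha, ← inter_assoc, encard_singleton, not_true, false_and, or_false, true_and]
      by_cases haA : a ∈ A <;> simp [haA]
    · have h' : ¬ (ξ ω ∩ D).encard = 1 := by rwa [encard_eq_one]
      simp [uniquePoint, dif_neg h, h']
  rw [hpre]
  exact (h1.inter h2).union (h1.compl.inter (MeasurableSet.const _))

lemma map_uniquePoint [Inhabited E] (hξ : IsPoissonProcess P ξ ν)
    (hD : MeasurableSet D) (hν : ν D ≠ ∞) :
    (P.restrict {ω | (ξ ω ∩ D).encard = 1}).map (uniquePoint ξ D) =
      ENNReal.ofReal (Real.exp (-(ν D).toReal)) • ν.restrict D := by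
  ext A hA
  have hm := hξ.measurable_uniquePoint hD
  rw [Measure.map_apply hm hA, Measure.restrict_apply (hm hA), Measure.smul_apply,
    Measure.restrict_apply hA, smul_eq_mul, inter_comm A D,
    ← hξ.prob_count_one_count_zero hD hν (hD.inter hA) inter_subset_left]
  congr 1
  ext ω
  simp only [mem_inter_iff, mem_preimage, mem_ofPred_eq]
  constructor
  · rintro ⟨h1, h2⟩
    obtain ⟨a, ha⟩ := encard_eq_one.1 h2
    rw [uniquePoint_eq ha] at h1
    rw [sdiff_self_inter, ← inter_assoc, ← inter_sdiff_assoc, ha,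
      sdiff_eq_empty.2 (singleton_subset_iff.2 h1)]
    simp [h1]
  · rintro ⟨h1, h2⟩
    obtain ⟨a, ha⟩ := encard_eq_one.1 h1
    have haD : ξ ω ∩ D = {a} := by
      rw [← ha, ← inter_union_sdiff D A, inter_union_distrib_left]
      rw [sdiff_self_inter, encard_eq_zero] at h2
      rw [h2, union_empty, inter_union_sdiff]
    rw [uniquePoint_eq haD, haD]
    have : a ∈ ξ ω ∩ (D ∩ A) := ha ▸ mem_singleton a
    exact ⟨this.2.2, encard_singleton a⟩

lemma setIntegral_count_zero (hξ : IsPoissonProcess P ξ ν) (hD : MeasurableSet D) (hν : ν D ≠ ∞)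
    {Y : Ω → ℝ} {c : ℝ} (hY : ∀ᵐ ω ∂P, ξ ω ∩ D = ∅ → Y ω = c) :
    ∫ ω in {ω | (ξ ω ∩ D).encard = 0}, Y ω ∂P = Real.exp (-(ν D).toReal) * c := by
  rw [setIntegral_congr_ae (hξ.measurableSet_count_eq hD 0) (g := fun _ => c)
    (hY.mono fun ω h hω => h (encard_eq_zero.1 hω)), setIntegral_const, Measure.real,
    hξ.prob_count_zero hD hν, ENNReal.toReal_ofReal (Real.exp_pos _).le, smul_eq_mul]

lemma setIntegral_count_one [Inhabited E] (hξ : IsPoissonProcess P ξ ν) (hD : MeasurableSet D)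
    (hν : ν D ≠ ∞) {Y : Ω → ℝ} {g : E → ℝ} (hg : Measurable g)
    (hY : ∀ᵐ ω ∂P, ∀ a, ξ ω ∩ D = {a} → Y ω = g a) :
    ∫ ω in {ω | (ξ ω ∩ D).encard = 1}, Y ω ∂P =
      Real.exp (-(ν D).toReal) * ∫ a in D, g a ∂ν := by
  have hYg : ∀ᵐ ω ∂P, (ξ ω ∩ D).encard = 1 → Y ω = g (uniquePoint ξ D ω) :=
    hY.mono fun ω h hω => by
      obtain ⟨a, ha⟩ := encard_eq_one.1 hω
      rw [uniquePoint_eq ha]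
      exact h a ha
  rw [setIntegral_congr_ae (hξ.measurableSet_count_eq hD 1) hYg,
    ← integral_map (f := g) (hξ.measurable_uniquePoint hD).aemeasurable
      hg.aestronglyMeasurable, hξ.map_uniquePoint hD hν, integral_smul_measure,
    ENNReal.toReal_ofReal (Real.exp_pos _).le, smul_eq_mul]

lemma measureReal_compl_count_zero_union_count_one (hξ : IsPoissonProcess P ξ ν)
    [IsProbabilityMeasure P] (hD : MeasurableSet D) (hν : ν D ≠ ∞) :
    P.real ({ω | (ξ ω ∩ D).encard = 0} ∪ {ω | (ξ ω ∩ D).encard = 1})ᶜ =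
      1 - Real.exp (-(ν D).toReal) * (1 + (ν D).toReal) := by
  have h0 := hξ.measurableSet_count_eq hD 0
  have h1 := hξ.measurableSet_count_eq hD 1
  rw [probReal_compl_eq_one_sub (h0.union h1),
    measureReal_union (disjoint_count_zero_count_one ξ D) h1, Measure.real, Measure.real,
    hξ.prob_count_zero hD hν, hξ.prob_count_one hD hν, ENNReal.toReal_mul,
    ENNReal.toReal_ofReal (Real.exp_pos _).le]
  ring

lemma abs_setIntegral_compl_le (hξ : IsPoissonProcess P ξ ν) [IsProbabilityMeasure P]
    (hD : MeasurableSet D) (hν : ν D ≠ ∞) {Y : Ω → ℝ} {B : ℝ} (hYB : ∀ ω, |Y ω| ≤ B) :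
    |∫ ω in ({ω | (ξ ω ∩ D).encard = 0} ∪ {ω | (ξ ω ∩ D).encard = 1})ᶜ, Y ω ∂P| ≤
      B * (1 - Real.exp (-(ν D).toReal) * (1 + (ν D).toReal)) := by
  rw [← hξ.measureReal_compl_count_zero_union_count_one hD hν]
  exact norm_setIntegral_le_of_norm_le_const (f := Y) (measure_lt_top _ _) fun ω _ => hYB ω

lemma integral_eq_sum_count (hξ : IsPoissonProcess P ξ ν) [Inhabited E]
    (hD : MeasurableSet D) (hν : ν D ≠ ∞) {Y : Ω → ℝ} {g : E → ℝ} {c : ℝ} (hY : Integrable Y P)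
    (hg : Measurable g) (h0 : ∀ᵐ ω ∂P, ξ ω ∩ D = ∅ → Y ω = c)
    (h1 : ∀ᵐ ω ∂P, ∀ a, ξ ω ∩ D = {a} → Y ω = g a) :
    ∫ ω, Y ω ∂P =
      Real.exp (-(ν D).toReal) * c + Real.exp (-(ν D).toReal) * (∫ a in D, g a ∂ν) +
        ∫ ω in ({ω | (ξ ω ∩ D).encard = 0} ∪ {ω | (ξ ω ∩ D).encard = 1})ᶜ, Y ω ∂P := by
  have hm₀ := hξ.measurableSet_count_eq hD 0
  have hm₁ := hξ.measurableSet_count_eq hD 1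
  rw [← integral_add_compl (hm₀.union hm₁) hY,
    setIntegral_union (disjoint_count_zero_count_one ξ D) hm₁ hY.integrableOn hY.integrableOn,
    hξ.setIntegral_count_zero hD hν h0, hξ.setIntegral_count_one hD hν hg h1]

lemma abs_integral_sub_le [Inhabited E] (hξ : IsPoissonProcess P ξ ν) [IsProbabilityMeasure P]
    (hD : MeasurableSet D) (hν : ν D ≠ ∞) {Y : Ω → ℝ} {g : E → ℝ} {c B : ℝ}
    (hY : AEStronglyMeasurable Y P) (hYB : ∀ ω, |Y ω| ≤ B) (hg : Measurable g)
    (hgB : ∀ a, |g a| ≤ B) (hc : |c| ≤ B) (h0 : ∀ᵐ ω ∂P, ξ ω ∩ D = ∅ → Y ω = c)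
    (h1 : ∀ᵐ ω ∂P, ∀ a, ξ ω ∩ D = {a} → Y ω = g a) :
    |(∫ ω, Y ω ∂P) - c - ∫ a in D, (g a - c) ∂ν| ≤ 4 * B * (ν D).toReal ^ 2 := by
  have : IsFiniteMeasure (ν.restrict D) := ⟨by simpa using hν.lt_top⟩
  have hgi : Integrable g (ν.restrict D) := .of_bound hg.aestronglyMeasurable B (.of_forall hgB)
  have hsplit := hξ.integral_eq_sum_count hD hν (.of_bound hY B (.of_forall hYB)) hg h0 h1
  have hR := hξ.abs_setIntegral_compl_le hD hν hYB
  set R := ∫ ω in ({ω | (ξ ω ∩ D).encard = 0} ∪ {ω | (ξ ω ∩ D).encard = 1})ᶜ, Y ω ∂P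
  set l := (ν D).toReal
  set J := ∫ a in D, (g a - c) ∂ν with hJ
  set q := 1 - Real.exp (-l) * (1 + l) with hq
  have hJg : ∫ a in D, g a ∂ν = J + c * l := by
    rw [hJ, integral_sub hgi (integrable_const _), setIntegral_const, smul_eq_mul, mul_comm c]
    exact (sub_add_cancel _ _).symm
  have hJB : |J| ≤ 2 * B * l :=
    norm_setIntegral_le_of_norm_le_const (f := fun a => g a - c) hν.lt_top
      fun a _ => (abs_sub _ _).trans (by linarith [hgB a])
  have hB : 0 ≤ B := (abs_nonneg _).trans hc
  have hl : 0 ≤ l := ENNReal.toReal_nonneg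
  have hexp : 1 - Real.exp (-l) ≤ l := by linarith [Real.add_one_le_exp (-l)]
  have hexp0 : 0 ≤ 1 - Real.exp (-l) := sub_nonneg.2 (Real.exp_le_one_iff.2 (by linarith))
  have hq0 : 0 ≤ q :=
    measureReal_nonneg.trans_eq (hξ.measureReal_compl_count_zero_union_count_one hD hν)
  calc |(∫ ω, Y ω ∂P) - c - J|
      = |R - c * q - J * (1 - Real.exp (-l))| := by rw [hsplit, hJg, hq]; ring_nf
    _ ≤ |R| + |c| * q + |J| * (1 - Real.exp (-l)) := by
        refine (abs_sub _ _).trans ((add_le_add_left (abs_sub _ _) _).trans_eq ?_)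
        rw [abs_mul, abs_mul, abs_of_nonneg hq0, abs_of_nonneg hexp0]
    _ ≤ B * l ^ 2 + B * l ^ 2 + 2 * B * l * l := by
        have hql : q ≤ l ^ 2 := one_sub_exp_neg_mul_le_sq hl
        gcongr
        exact hR.trans (mul_le_mul_of_nonneg_left hql hB)
    _ = 4 * B * l ^ 2 := by ring

end IsPoissonProcess

/-! ### The gas near the piston -/

/-- `η = 2m/(M+m)` is so small, compared to the velocity cutoffs, that an atom hits the piston at
most once and that the reflection keeps the piston velocity in `[-Vbar, Vbar]`. -/
structure IsHeavy (vmin vmax Vbar η : ℝ) : Prop where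
  vmin_pos : 0 < vmin
  vmin_lt : vmin < vmax
  Vbar_pos : 0 < Vbar
  pos : 0 < η
  no_recollision : 3 * Vbar < (1 - η) * vmin
  small_kick : η * (vmax + Vbar) ≤ Vbar / 2

/-- The velocity of the piston after it is hit, with velocity `u`, by an atom of velocity `v`. -/
noncomputable def kick (Vbar η u v : ℝ) : ℝ := reflect Vbar (u + η * (v - u))

/-- The strip of half-width `r` around the piston. -/
def slab (r : ℝ) : Set (ℝ × ℝ) := {a | |a.1| ≤ r}

/-- The atoms that hit, during `(0, h]`, a piston of constant velocity `u`. -/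
def hitSet (u h : ℝ) : Set (ℝ × ℝ) :=
  {a | (-(h * (a.2 - u)) ≤ a.1 ∧ a.1 < 0) ∨ (0 < a.1 ∧ a.1 ≤ h * (u - a.2))}

lemma measurableSet_slab (r : ℝ) : MeasurableSet (slab r) :=
  measurableSet_le (by fun_prop) (by fun_prop)

lemma measurableSet_hitSet (u h : ℝ) : MeasurableSet (hitSet u h) := by
  unfold hitSet
  measurability

lemma measurable_reflect (Vbar : ℝ) : Measurable (reflect Vbar) :=
  Measurable.ite measurableSet_Ioi (by fun_prop)
    (Measurable.ite measurableSet_Iio (by fun_prop) (by fun_prop))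

lemma measurable_kick (Vbar η : ℝ) : Measurable fun z : ℝ × ℝ => kick Vbar η z.1 z.2 :=
  (measurable_reflect Vbar).comp (by fun_prop)

lemma abs_reflect_le {Vbar V : ℝ} (h : |V| ≤ 3 * Vbar) : |reflect Vbar V| ≤ Vbar := by
  rw [abs_le] at h ⊢
  unfold reflect
  split_ifs <;> constructor <;> linarith

lemma reflect_pistonAfter {m M : ℝ} (h : M + m ≠ 0) (Vbar u v : ℝ) :
    reflect Vbar (pistonAfter m M u v) = kick Vbar (2 * m / (M + m)) u v := by
  unfold pistonAfter kick
  congr 1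
  field_simp
  ring

lemma atomAfter_eq {m M : ℝ} (h : M + m ≠ 0) (u v : ℝ) :
    atomAfter m M u v = -(1 - 2 * m / (M + m)) * v + (2 - 2 * m / (M + m)) * u := by
  unfold atomAfter
  field_simp
  ring

lemma exists_hit_iff {u h : ℝ} (hh : 0 < h) {a : ℝ × ℝ} (hau : a.2 ≠ u) :
    (∃ t ∈ Ioc 0 h, a.1 + a.2 * t = u * t) ↔ a ∈ hitSet u h := by
  constructor
  · rintro ⟨t, ⟨ht0, hth⟩, ht⟩
    rcases lt_or_gt_of_ne hau with hlt | hlt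
    · exact Or.inr ⟨by nlinarith, by nlinarith⟩
    · exact Or.inl ⟨by nlinarith, by nlinarith⟩
  · rintro (⟨h1, h2⟩ | ⟨h1, h2⟩)
    · have hlt : 0 < a.2 - u := pos_of_mul_pos_right (by linarith : 0 < h * (a.2 - u)) hh.le
      refine ⟨-a.1 / (a.2 - u), ⟨div_pos (by linarith) hlt, ?_⟩, by field_simp; ring⟩
      rw [div_le_iff₀ hlt]
      linarith
    · have hlt : 0 < u - a.2 := pos_of_mul_pos_right (by linarith : 0 < h * (u - a.2)) hh.le
      refine ⟨a.1 / (u - a.2), ⟨div_pos (by linarith) hlt, ?_⟩, by field_simp; ring⟩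
      rwa [div_le_iff₀ hlt]

lemma mem_slab_inter_hitSet_iff_of_lt {K u h x v : ℝ} (hh : 0 ≤ h) (huv : u < v)
    (hK : v - u ≤ K) : (x, v) ∈ slab (K * h) ∩ hitSet u h ↔ x ∈ Ico (-(h * (v - u))) 0 := by
  constructor
  · rintro ⟨-, hx | ⟨hx, hx'⟩⟩
    · exact hx
    · dsimp only at hx hx'
      nlinarith
  · intro hx
    refine ⟨?_, Or.inl hx⟩
    change |x| ≤ K * h
    rw [abs_of_neg hx.2]
    nlinarith [hx.1]

lemma mem_slab_inter_hitSet_iff_of_gt {K u h x v : ℝ} (hh : 0 ≤ h) (hvu : v < u)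
    (hK : u - v ≤ K) : (x, v) ∈ slab (K * h) ∩ hitSet u h ↔ x ∈ Ioc 0 (h * (u - v)) := by
  constructor
  · rintro ⟨-, ⟨hx, hx'⟩ | hx⟩
    · dsimp only at hx hx'
      nlinarith
    · exact hx
  · intro hx
    refine ⟨?_, Or.inr hx⟩
    change |x| ≤ K * h
    rw [abs_of_pos hx.1]
    nlinarith [hx.2]

/-- The density `p(x, v)` of `gasIntensity` at `a = (x, v)`. -/
noncomputable def gasDensity (pminus pplus : ℝ → ℝ) (a : ℝ × ℝ) : ℝ :=
  if a.1 < 0 then pminus a.2 else pplus a.2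

/-- `p_-` on the right half line and `-p_+` on the left half line: the atoms of velocity `v` hit a
piston of velocity `u` at rate `(v - u) * signedDensity pminus pplus v`. -/
noncomputable def signedDensity (pminus pplus : ℝ → ℝ) (v : ℝ) : ℝ :=
  if 0 < v then pminus v else -pplus v

lemma measurable_gasDensity {pminus pplus : ℝ → ℝ} (hm : Measurable pminus)
    (hp : Measurable pplus) : Measurable (gasDensity pminus pplus) :=
  Measurable.ite (measurableSet_lt (by fun_prop) (by fun_prop)) (hm.comp measurable_snd)
    (hp.comp measurable_snd)

lemma gasIntensity_eq_withDensity (pminus pplus : ℝ → ℝ) :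
    gasIntensity pminus pplus =
      volume.withDensity fun a => ENNReal.ofReal (gasDensity pminus pplus a) :=
  rfl

section Gas

variable {vmin vmax : ℝ} {pminus pplus : ℝ → ℝ} (hm : IsGasDensity vmin vmax pminus)
  (hp : IsGasDensity vmin vmax pplus)
include hm hp

lemma gasDensity_nonneg (a : ℝ × ℝ) : 0 ≤ gasDensity pminus pplus a := by
  unfold gasDensity
  split_ifs
  exacts [hm.nonneg _, hp.nonneg _]

lemma gasDensity_le (a : ℝ × ℝ) : gasDensity pminus pplus a ≤ pminus a.2 + pplus a.2 := by
  unfold gasDensity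
  split_ifs
  exacts [le_add_of_nonneg_right (hp.nonneg _), le_add_of_nonneg_left (hm.nonneg _)]

lemma gasDensity_eq_zero {a : ℝ × ℝ} (ha : |a.2| ≤ vmin ∨ vmax ≤ |a.2|) :
    gasDensity pminus pplus a = 0 := by
  simp [gasDensity, hm.cutoff _ ha, hp.cutoff _ ha]

lemma signedDensity_eq_zero {v : ℝ} (hv : |v| ≤ vmin ∨ vmax ≤ |v|) :
    signedDensity pminus pplus v = 0 := by
  simp [signedDensity, hm.cutoff v hv, hp.cutoff v hv]

lemma ae_forall_mem_cutoff {Ω : Type*} [MeasurableSpace Ω] {P : Measure Ω}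
    [IsProbabilityMeasure P] {ξ : Ω → Set (ℝ × ℝ)}
    (hξ : IsPoissonProcess P ξ (gasIntensity pminus pplus)) :
    ∀ᵐ ω ∂P, ∀ a ∈ ξ ω, vmin < |a.2| ∧ |a.2| < vmax := by
  have hS : MeasurableSet {a : ℝ × ℝ | |a.2| ≤ vmin ∨ vmax ≤ |a.2|} :=
    (measurableSet_le (f := fun a : ℝ × ℝ => |a.2|) (g := fun _ => vmin)
      (by fun_prop) (by fun_prop)).union
      (measurableSet_le (f := fun _ => vmax) (g := fun a : ℝ × ℝ => |a.2|)
        (by fun_prop) (by fun_prop))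
  have hnull : gasIntensity pminus pplus {a | |a.2| ≤ vmin ∨ vmax ≤ |a.2|} = 0 := by
    rw [gasIntensity_eq_withDensity, withDensity_apply _ hS]
    refine (setLIntegral_congr_fun hS (g := fun _ => 0) fun a ha => ?_).trans (by simp)
    simp [gasDensity_eq_zero hm hp ha]
  filter_upwards [hξ.ae_inter_eq_empty hS hnull] with ω hω a ha
  by_contra hcon
  have hmem : a ∈ ξ ω ∩ {a | |a.2| ≤ vmin ∨ vmax ≤ |a.2|} :=
    ⟨ha, (not_and_or.1 hcon).imp not_lt.1 not_lt.1⟩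
  exact notMem_empty a (hω ▸ hmem)

lemma gasIntensity_slab_le (r : ℝ) :
    gasIntensity pminus pplus (slab r) ≤ ENNReal.ofReal (2 * r * ∫ v, (pminus v + pplus v)) := by
  have hi : Integrable fun v => pminus v + pplus v := hm.integrable.add hp.integrable
  have h0 : ∀ v, 0 ≤ pminus v + pplus v := fun v => add_nonneg (hm.nonneg v) (hp.nonneg v)
  have hslab : slab r = Icc (-r) r ×ˢ univ := by
    ext a
    simp [slab, abs_le]
  have hmeas : Measurable fun a : ℝ × ℝ => ENNReal.ofReal (pminus a.2 + pplus a.2) :=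
    ((hm.measurable.add hp.measurable).comp measurable_snd).ennreal_ofReal
  calc gasIntensity pminus pplus (slab r)
      = ∫⁻ a in slab r, ENNReal.ofReal (gasDensity pminus pplus a) :=
        withDensity_apply _ (measurableSet_slab r)
    _ ≤ ∫⁻ a in slab r, ENNReal.ofReal (pminus a.2 + pplus a.2) :=
        lintegral_mono fun a => ENNReal.ofReal_le_ofReal (gasDensity_le hm hp a)
    _ = ENNReal.ofReal (2 * r * ∫ v, (pminus v + pplus v)) := by
        rw [hslab, Measure.volume_eq_prod, ← Measure.prod_restrict, Measure.restrict_univ,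
          lintegral_prod _ hmeas.aemeasurable]
        simp only [lintegral_const, Measure.restrict_apply_univ, Real.volume_Icc]
        rw [← ofReal_integral_eq_lintegral_ofReal hi (.of_forall h0),
          ← ENNReal.ofReal_mul (integral_nonneg h0)]
        congr 1
        ring

lemma integral_indicator_hit {Vbar u h : ℝ} (hvmin : 0 < vmin) (hVbar : Vbar < vmin)
    (hu : |u| ≤ Vbar) (hh : 0 ≤ h) (φ : ℝ → ℝ) (v : ℝ) :
    ∫ x, (slab ((vmax + Vbar) * h) ∩ hitSet u h).indicator
      (fun a => gasDensity pminus pplus a * φ a.2) (x, v) =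
      h * (signedDensity pminus pplus v * ((v - u) * φ v)) := by
  by_cases hv : |v| ≤ vmin ∨ vmax ≤ |v|
  · simp [signedDensity_eq_zero hm hp hv, gasDensity, hm.cutoff v hv, hp.cutoff v hv, indicator]
  push Not at hv
  obtain ⟨hv1, hv2⟩ := hv
  rw [abs_le] at hu
  rw [abs_lt] at hv2
  rcases lt_abs.1 hv1 with hpos | hneg
  · have hslice : ∀ x, (slab ((vmax + Vbar) * h) ∩ hitSet u h).indicator
        (fun a => gasDensity pminus pplus a * φ a.2) (x, v) =
        (Ico (-(h * (v - u))) 0).indicator (fun _ => pminus v * φ v) x := fun x => by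
      simp only [indicator, mem_slab_inter_hitSet_iff_of_lt hh (by linarith : u < v)
        (by linarith : v - u ≤ vmax + Vbar)]
      split_ifs with hx
      exacts [by simp [gasDensity, hx.2], rfl]
    simp_rw [hslice]
    rw [integral_indicator measurableSet_Ico, setIntegral_const, Real.volume_real_Ico_of_le
      (by nlinarith), signedDensity, if_pos (by linarith), smul_eq_mul]
    ring
  · have hslice : ∀ x, (slab ((vmax + Vbar) * h) ∩ hitSet u h).indicator
        (fun a => gasDensity pminus pplus a * φ a.2) (x, v) =
        (Ioc 0 (h * (u - v))).indicator (fun _ => pplus v * φ v) x := fun x => by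
      simp only [indicator, mem_slab_inter_hitSet_iff_of_gt hh (by linarith : v < u)
        (by linarith : u - v ≤ vmax + Vbar)]
      split_ifs with hx
      exacts [by simp [gasDensity, hx.1.le], rfl]
    simp_rw [hslice]
    rw [integral_indicator measurableSet_Ioc, setIntegral_const, Real.volume_real_Ioc_of_le
      (by nlinarith), signedDensity, if_neg (by linarith), smul_eq_mul]
    ring

lemma integrable_indicator_hit {B : ℝ} {φ : ℝ → ℝ} (hφ : Measurable φ)
    (hφB : ∀ v, |φ v| ≤ B) (u h r : ℝ) :
    Integrable ((slab r ∩ hitSet u h).indicator fun a => gasDensity pminus pplus a * φ a.2)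
      (volume.prod volume) := by
  have hstrip : Integrable ((Icc (-r) r).indicator fun _ : ℝ => (1 : ℝ)) :=
    (integrableOn_const (by simp) (by simp)).integrable_indicator measurableSet_Icc
  have hgas : Integrable fun v => (pminus v + pplus v) * B :=
    (hm.integrable.add hp.integrable).mul_const B
  have hmeas : Measurable fun a => gasDensity pminus pplus a * φ a.2 :=
    (measurable_gasDensity hm.measurable hp.measurable).mul (hφ.comp measurable_snd)
  refine (hstrip.mul_prod hgas).mono' (hmeas.indicator
    ((measurableSet_slab r).inter (measurableSet_hitSet u h))).aestronglyMeasurable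
    (.of_forall fun a => ?_)
  have h0 : 0 ≤ pminus a.2 + pplus a.2 := add_nonneg (hm.nonneg _) (hp.nonneg _)
  by_cases ha : a ∈ slab r ∩ hitSet u h
  · have ha1 : a.1 ∈ Icc (-r) r := abs_le.1 ha.1
    rw [indicator_of_mem ha, indicator_of_mem ha1, one_mul, norm_mul, Real.norm_eq_abs,
      Real.norm_eq_abs, abs_of_nonneg (gasDensity_nonneg hm hp a)]
    exact mul_le_mul (gasDensity_le hm hp a) (hφB _) (abs_nonneg _) h0
  · rw [indicator_of_notMem ha, norm_zero]
    exact mul_nonneg (indicator_nonneg (by simp) _)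
      (mul_nonneg h0 ((abs_nonneg _).trans (hφB 0)))

lemma setIntegral_hit {Vbar u h B : ℝ} (hvmin : 0 < vmin) (hVbar : Vbar < vmin)
    (hu : |u| ≤ Vbar) (hh : 0 ≤ h) {φ : ℝ → ℝ} (hφ : Measurable φ) (hφB : ∀ v, |φ v| ≤ B) :
    ∫ a in slab ((vmax + Vbar) * h), (hitSet u h).indicator (fun a => φ a.2) a
        ∂gasIntensity pminus pplus =
      h * ∫ v, signedDensity pminus pplus v * ((v - u) * φ v) := by
  have hD := measurableSet_slab ((vmax + Vbar) * h)
  have hindicator : (slab ((vmax + Vbar) * h)).indicator (fun a =>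
      (ENNReal.ofReal (gasDensity pminus pplus a)).toReal •
        (hitSet u h).indicator (fun a => φ a.2) a) =
      (slab ((vmax + Vbar) * h) ∩ hitSet u h).indicator
        fun a => gasDensity pminus pplus a * φ a.2 := by
    ext a
    by_cases h1 : a ∈ slab ((vmax + Vbar) * h) <;> by_cases h2 : a ∈ hitSet u h <;>
      simp [h1, h2, gasDensity_nonneg hm hp a]
  rw [gasIntensity_eq_withDensity, setIntegral_withDensity_eq_setIntegral_toReal_smul
    (measurable_gasDensity hm.measurable hp.measurable).ennreal_ofReal
    (.of_forall fun a => ENNReal.ofReal_lt_top) _ hD, ← integral_indicator hD, hindicator,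
    Measure.volume_eq_prod, integral_prod_symm _ (integrable_indicator_hit hm hp hφ hφB u h _),
    ← integral_const_mul]
  exact integral_congr_ae (.of_forall (integral_indicator_hit hm hp hvmin hVbar hu hh φ))

end Gas

/-! ### The generator of the velocity process -/

/-- `g v` is the signed intensity of the atoms of velocity `v` that can hit the piston: the faster
atoms, of velocity `v > 0`, come from the left and count positively, the slower ones come from the
right and count negatively. The generator depends on the two gases through `g` only. -/
structure IsCollisionWeight (vmin vmax : ℝ) (g : ℝ → ℝ) : Prop where
  measurable : Measurable g
  integrable : Integrable g
  sign : ∀ v, 0 ≤ g v * v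
  cutoff : ∀ v, |v| ≤ vmin ∨ vmax ≤ |v| → g v = 0
  pos : 0 < ∫ v, |g v|

/-- The generator of the velocity process: a piston of velocity `u`, with `|u| ≤ Vbar`, is hit by
the atoms of velocity `v` at rate `(v - u) * g v`. -/
noncomputable def generator (Vbar η : ℝ) (g f : ℝ → ℝ) (u : ℝ) : ℝ :=
  ∫ v, g v * ((v - u) * (f (kick Vbar η u v) - f u))

lemma measurable_signedDensity {pminus pplus : ℝ → ℝ} (hm : Measurable pminus)
    (hp : Measurable pplus) : Measurable (signedDensity pminus pplus) :=
  Measurable.ite measurableSet_Ioi hm hp.neg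

lemma abs_signedDensity_le {vmin vmax : ℝ} {pminus pplus : ℝ → ℝ}
    (hm : IsGasDensity vmin vmax pminus) (hp : IsGasDensity vmin vmax pplus) (v : ℝ) :
    |signedDensity pminus pplus v| ≤ pminus v + pplus v := by
  have h1 := hm.nonneg v
  have h2 := hp.nonneg v
  unfold signedDensity
  split_ifs
  · rw [abs_of_nonneg h1]
    linarith
  · rw [abs_neg, abs_of_nonneg h2]
    linarith

lemma integrable_signedDensity {vmin vmax : ℝ} {pminus pplus : ℝ → ℝ}
    (hm : IsGasDensity vmin vmax pminus) (hp : IsGasDensity vmin vmax pplus) :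
    Integrable (signedDensity pminus pplus) :=
  (hm.integrable.add hp.integrable).mono'
    (measurable_signedDensity hm.measurable hp.measurable).aestronglyMeasurable
    (.of_forall fun v => abs_signedDensity_le hm hp v)

lemma integral_abs_signedDensity_pos {vmin vmax : ℝ} {pminus pplus : ℝ → ℝ}
    (hm : IsGasDensity vmin vmax pminus) (hp : IsGasDensity vmin vmax pplus) :
    0 < ∫ v, |signedDensity pminus pplus v| := by
  have hhalf : ∫ v, pminus v = 2 * ∫ v in Ioi 0, pminus v := by
    rw [← integral_comp_abs]
    refine integral_congr_ae (.of_forall fun v => ?_)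
    rcases abs_choice v with h | h <;> simp [h, hm.even]
  have hpos : 0 < ∫ v in Ioi 0, pminus v := by linarith [hm.pos]
  refine hpos.trans_le ?_
  rw [← integral_indicator measurableSet_Ioi]
  refine integral_mono (hm.integrable.indicator measurableSet_Ioi)
    (integrable_signedDensity hm hp).abs fun v => ?_
  by_cases hv : v ∈ Ioi (0 : ℝ)
  · rw [indicator_of_mem hv, signedDensity, if_pos (mem_Ioi.1 hv)]
    exact le_abs_self _
  · rw [indicator_of_notMem hv]
    exact abs_nonneg _

lemma isCollisionWeight_signedDensity {vmin vmax : ℝ} {pminus pplus : ℝ → ℝ}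
    (hm : IsGasDensity vmin vmax pminus) (hp : IsGasDensity vmin vmax pplus) :
    IsCollisionWeight vmin vmax (signedDensity pminus pplus) where
  measurable := measurable_signedDensity hm.measurable hp.measurable
  integrable := integrable_signedDensity hm hp
  sign v := by
    unfold signedDensity
    split_ifs with hv
    · exact mul_nonneg (hm.nonneg v) hv.le
    · exact mul_nonneg_of_nonpos_of_nonpos (neg_nonpos.2 (hp.nonneg v)) (not_lt.1 hv)
  cutoff v hv := signedDensity_eq_zero hm hp hv
  pos := integral_abs_signedDensity_pos hm hp

namespace IsHeavy

variable {vmin vmax Vbar η : ℝ} (H : IsHeavy vmin vmax Vbar η)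
include H

lemma Vbar_lt : 3 * Vbar < vmin := by
  nlinarith [H.no_recollision, mul_pos H.pos H.vmin_pos]

lemma add_pos : 0 < vmax + Vbar := by
  linarith [H.vmin_pos, H.vmin_lt, H.Vbar_pos]

lemma abs_mul_sub_le {u v : ℝ} (hu : |u| ≤ Vbar) (hv : |v| ≤ vmax) :
    |η * (v - u)| ≤ Vbar / 2 := by
  rw [abs_mul, abs_of_pos H.pos]
  refine le_trans ?_ H.small_kick
  exact mul_le_mul_of_nonneg_left ((abs_sub v u).trans (add_le_add hv hu)) H.pos.le

lemma abs_kick_le {u v : ℝ} (hu : |u| ≤ Vbar) (hv : |v| ≤ vmax) : |kick Vbar η u v| ≤ Vbar := by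
  refine abs_reflect_le ((abs_add_le _ _).trans ?_)
  linarith [H.abs_mul_sub_le hu hv, H.Vbar_pos]

lemma ne_velocity {u : ℝ} (hu : |u| ≤ Vbar) {a : ℝ × ℝ} (ha : vmin < |a.2| ∧ |a.2| ≤ vmax) :
    a.2 ≠ u ∧ |a.2| ≤ vmax :=
  ⟨fun heq => by linarith [heq ▸ ha.1, H.Vbar_lt, H.Vbar_pos], ha.2⟩

lemma atom_ne_kick {u v : ℝ} (hu : |u| ≤ Vbar) (hv : vmin < |v|) (hv' : |v| ≤ vmax) :
    -(1 - η) * v + (2 - η) * u ≠ kick Vbar η u v := by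
  have hη1 : 0 < 1 - η := pos_of_mul_pos_left (by linarith [H.no_recollision, H.Vbar_pos])
    H.vmin_pos.le
  have hη2 := mul_pos H.pos H.Vbar_pos
  have hgap := H.no_recollision
  obtain ⟨hk, hk'⟩ := abs_le.1 (H.abs_kick_le hu hv')
  obtain ⟨hul, hur⟩ := abs_le.1 hu
  intro heq
  rcases lt_abs.1 hv with h | h
  · nlinarith [mul_lt_mul_of_pos_left h hη1]
  · nlinarith [mul_lt_mul_of_pos_left h hη1]

end IsHeavy

lemma Evolution.eq_of_forall_notMem_hitSet {m M Vbar u h vmax : ℝ} {A : Set (ℝ × ℝ)}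
    {X W : ℝ → ℝ} {y w : ℝ × ℝ → ℝ → ℝ} (E : Evolution m M Vbar u A X W y w) (hu : |u| ≤ Vbar)
    (hh : 0 < h) (hA : ∀ a ∈ A, a.2 ≠ u ∧ |a.2| ≤ vmax)
    (hmiss : ∀ a ∈ A ∩ slab ((vmax + Vbar) * h), a ∉ hitSet u h) : W h = u := by
  refine E.piston_free_flight (T := h) (fun a ha t ht heq => ?_) h ⟨hh.le, le_rfl⟩
  by_cases haD : a ∈ slab ((vmax + Vbar) * h)
  · exact hmiss a ⟨ha, haD⟩ ((exists_hit_iff hh (hA a ha).1).1 ⟨t, ht, heq⟩)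
  · exact ne_mul_of_mul_lt_abs hu ht.1.le (mul_lt_abs_add_mul ((abs_nonneg u).trans hu)
      (hA a ha).2 (not_le.1 haD) ⟨ht.1.le, ht.2⟩) heq

lemma Evolution.eq_kick_of_mem_hitSet {m M Vbar u h vmin vmax : ℝ} {A : Set (ℝ × ℝ)}
    {X W : ℝ → ℝ} {y w : ℝ × ℝ → ℝ → ℝ} (E : Evolution m M Vbar u A X W y w) (hmM : M + m ≠ 0)
    (H : IsHeavy vmin vmax Vbar (2 * m / (M + m))) (hu : |u| ≤ Vbar) (hh : 0 < h)
    (hA : ∀ a ∈ A, vmin < |a.2| ∧ |a.2| ≤ vmax) {a : ℝ × ℝ}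
    (ha : A ∩ slab ((vmax + Vbar) * h) = {a}) (hhit : a ∈ hitSet u h) :
    W h = kick Vbar (2 * m / (M + m)) u a.2 := by
  have haA : a ∈ A := (ha.symm ▸ mem_singleton a : a ∈ A ∩ _).1
  obtain ⟨hva, hva'⟩ := hA a haA
  have hau : a.2 ≠ u := (H.ne_velocity hu (hA a haA)).1
  obtain ⟨τ, hτ, hmeet⟩ := (exists_hit_iff hh hau).2 hhit
  have hfar : ∀ b ∈ A, b ≠ a → ∀ t ∈ Ioc 0 h, Vbar * t < |b.1 + b.2 * t| := by
    intro b hb hba t ht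
    have hbD : b ∉ slab ((vmax + Vbar) * h) := fun hbD =>
      hba (ha ▸ (⟨hb, hbD⟩ : b ∈ A ∩ slab ((vmax + Vbar) * h)) : b ∈ ({a} : Set (ℝ × ℝ)))
    exact mul_lt_abs_add_mul H.Vbar_pos.le (hA b hb).2 (not_le.1 hbD) ⟨ht.1.le, ht.2⟩
  rw [← reflect_pistonAfter hmM]
  refine E.piston_one_collision hu haA hau hτ hmeet hfar ?_ ?_
  · rw [reflect_pistonAfter hmM]
    exact H.abs_kick_le hu hva'
  · rw [reflect_pistonAfter hmM, atomAfter_eq hmM]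
    exact H.atom_ne_kick hu hva hva'

open Classical in
/-- The velocity, at time `h`, of a piston that starts with velocity `u` and can only meet the
atom `a`. -/
noncomputable def velocityAfter (Vbar η u h : ℝ) (a : ℝ × ℝ) : ℝ :=
  if a ∈ hitSet u h then kick Vbar η u a.2 else u

lemma measurable_velocityAfter (Vbar η u h : ℝ) : Measurable (velocityAfter Vbar η u h) :=
  Measurable.ite (measurableSet_hitSet u h)
    ((measurable_kick Vbar η).comp (by fun_prop : Measurable fun a : ℝ × ℝ => (u, a.2)))
    measurable_const

lemma comp_velocityAfter_sub (f : ℝ → ℝ) (Vbar η u h : ℝ) (a : ℝ × ℝ) :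
    f (velocityAfter Vbar η u h a) - f u =
      (hitSet u h).indicator (fun a => f (kick Vbar η u a.2) - f u) a := by
  unfold velocityAfter
  split_ifs with ha <;> simp [ha]

lemma Evolution.eq_velocityAfter {m M Vbar u h vmin vmax : ℝ} {A : Set (ℝ × ℝ)}
    {X W : ℝ → ℝ} {y w : ℝ × ℝ → ℝ → ℝ} (E : Evolution m M Vbar u A X W y w) (hmM : M + m ≠ 0)
    (H : IsHeavy vmin vmax Vbar (2 * m / (M + m))) (hu : |u| ≤ Vbar) (hh : 0 < h)
    (hA : ∀ a ∈ A, vmin < |a.2| ∧ |a.2| ≤ vmax) {a : ℝ × ℝ}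
    (ha : A ∩ slab ((vmax + Vbar) * h) = {a}) :
    W h = velocityAfter Vbar (2 * m / (M + m)) u h a := by
  unfold velocityAfter
  split_ifs with hhit
  · exact E.eq_kick_of_mem_hitSet hmM H hu hh hA ha hhit
  · exact E.eq_of_forall_notMem_hitSet hu hh (fun b hb => H.ne_velocity hu (hA b hb))
      fun b hb => (ha ▸ hb : b ∈ ({a} : Set (ℝ × ℝ))) ▸ hhit

section ShortTime

variable {vmin vmax Vbar m M : ℝ} {pminus pplus : ℝ → ℝ} (hm : IsGasDensity vmin vmax pminus)
  (hp : IsGasDensity vmin vmax pplus)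
include hm hp

lemma toReal_gasIntensity_slab_le {h : ℝ} (hK : 0 ≤ vmax + Vbar) (hh : 0 ≤ h) :
    (gasIntensity pminus pplus (slab ((vmax + Vbar) * h))).toReal ≤
      2 * (vmax + Vbar) * (∫ v, (pminus v + pplus v)) * h := by
  have hI : 0 ≤ ∫ v, (pminus v + pplus v) :=
    integral_nonneg fun v => add_nonneg (hm.nonneg v) (hp.nonneg v)
  refine (ENNReal.toReal_mono ENNReal.ofReal_ne_top (gasIntensity_slab_le hm hp _)).trans_eq ?_
  rw [ENNReal.toReal_ofReal (by positivity)]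
  ring

lemma abs_integral_sub_generator_le (hmM : M + m ≠ 0)
    (H : IsHeavy vmin vmax Vbar (2 * m / (M + m))) {u h B : ℝ} (hu : |u| ≤ Vbar) (hh : 0 < h)
    {f : ℝ → ℝ} (hf : Measurable f) (hfB : ∀ x, |f x| ≤ B)
    {Ω : Type*} [MeasurableSpace Ω] {P : Measure Ω} [IsProbabilityMeasure P]
    {ξ : Ω → Set (ℝ × ℝ)} {W : ℝ → Ω → ℝ}
    (hξ : IsPoissonProcess P ξ (gasIntensity pminus pplus)) (hW : AEMeasurable (W h) P)
    (hE : ∀ᵐ ω ∂P, ∃ (X : ℝ → ℝ) (y w : ℝ × ℝ → ℝ → ℝ),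
      Evolution m M Vbar u (ξ ω) X (fun t => W t ω) y w) :
    |(∫ ω, f (W h ω) ∂P) - f u -
        h * generator Vbar (2 * m / (M + m)) (signedDensity pminus pplus) f u| ≤
      4 * B * (2 * (vmax + Vbar) * ∫ v, (pminus v + pplus v)) ^ 2 * h ^ 2 := by
  set η := 2 * m / (M + m)
  have hφ : Measurable fun v => f (kick Vbar η u v) - f u :=
    (hf.comp ((measurable_kick Vbar η).comp
      (by fun_prop : Measurable fun v : ℝ => (u, v)))).sub_const _
  have hφB : ∀ v, |f (kick Vbar η u v) - f u| ≤ 2 * B := fun v =>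
    (abs_sub _ _).trans ((add_le_add (hfB _) (hfB _)).trans_eq (two_mul B).symm)
  have hcut := ae_forall_mem_cutoff hm hp hξ
  have hnone : ∀ᵐ ω ∂P, ξ ω ∩ slab ((vmax + Vbar) * h) = ∅ → f (W h ω) = f u := by
    filter_upwards [hE, hcut] with ω ⟨X, y, w, E⟩ hω hω0
    exact congrArg f (E.eq_of_forall_notMem_hitSet hu hh
      (fun a ha => H.ne_velocity hu ⟨(hω a ha).1, (hω a ha).2.le⟩)
      fun a ha => (hω0 ▸ ha : a ∈ (∅ : Set (ℝ × ℝ))).elim)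
  have hone : ∀ᵐ ω ∂P, ∀ a, ξ ω ∩ slab ((vmax + Vbar) * h) = {a} →
      f (W h ω) = f (velocityAfter Vbar η u h a) := by
    filter_upwards [hE, hcut] with ω ⟨X, y, w, E⟩ hω a hω1
    exact congrArg f (E.eq_velocityAfter hmM H hu hh
      (fun b hb => ⟨(hω b hb).1, (hω b hb).2.le⟩) hω1)
  have hgen : ∫ a in slab ((vmax + Vbar) * h), (f (velocityAfter Vbar η u h a) - f u)
      ∂gasIntensity pminus pplus = h * generator Vbar η (signedDensity pminus pplus) f u := by
    simp only [comp_velocityAfter_sub]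
    exact setIntegral_hit hm hp H.vmin_pos (by linarith [H.Vbar_lt, H.Vbar_pos]) hu hh.le hφ hφB
  have hfinite : gasIntensity pminus pplus (slab ((vmax + Vbar) * h)) ≠ ∞ :=
    ne_top_of_le_ne_top ENNReal.ofReal_ne_top (gasIntensity_slab_le hm hp _)
  have hB : 0 ≤ B := (abs_nonneg _).trans (hfB 0)
  rw [← hgen]
  refine (hξ.abs_integral_sub_le (measurableSet_slab _) hfinite
    (hf.comp_aemeasurable hW).aestronglyMeasurable (fun ω => hfB _)
    (hf.comp (measurable_velocityAfter Vbar η u h)) (fun a => hfB _) (hfB u) hnone hone).trans ?_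
  rw [mul_assoc (4 * B), ← mul_pow]
  gcongr
  exact toReal_gasIntensity_slab_le hm hp H.add_pos.le hh.le

end ShortTime

/-! ### The stationarity equation -/

lemma exists_abs_le_of_continuous {f : ℝ → ℝ} (hf : Continuous f) (V : ℝ) :
    ∃ B, ∀ x, |x| ≤ V → |f x| ≤ B := by
  obtain ⟨B, hB⟩ := (isCompact_Icc (a := -V) (b := V)).exists_bound_of_continuousOn
    hf.continuousOn
  exact ⟨B, fun x hx => hB x (abs_le.1 hx)⟩

namespace IsCollisionWeight

variable {vmin vmax : ℝ} {g : ℝ → ℝ} (G : IsCollisionWeight vmin vmax g) {φ : ℝ → ℝ} {B : ℝ}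
include G

lemma abs_mul_le (hB : ∀ v, |v| ≤ vmax → |φ v| ≤ B) (v : ℝ) : |g v * φ v| ≤ |g v| * B := by
  rcases le_or_gt vmax |v| with hv | hv
  · simp [G.cutoff v (Or.inr hv)]
  · rw [abs_mul]
    exact mul_le_mul_of_nonneg_left (hB v hv.le) (abs_nonneg _)

lemma integrable_mul (hφ : Measurable φ) (hB : ∀ v, |v| ≤ vmax → |φ v| ≤ B) :
    Integrable fun v => g v * φ v :=
  (G.integrable.abs.mul_const B).mono' (G.measurable.mul hφ).aestronglyMeasurable
    (.of_forall (G.abs_mul_le hB))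

lemma integrable_mul_of_continuous (hφ : Continuous φ) : Integrable fun v => g v * φ v := by
  obtain ⟨B, hB⟩ := exists_abs_le_of_continuous hφ vmax
  exact G.integrable_mul hφ.measurable hB

lemma abs_integral_mul_le (hB : ∀ v, |v| ≤ vmax → |φ v| ≤ B) :
    |∫ v, g v * φ v| ≤ (∫ v, |g v|) * B := by
  rw [← integral_mul_const, ← Real.norm_eq_abs]
  exact norm_integral_le_of_norm_le (G.integrable.abs.mul_const B) (.of_forall (G.abs_mul_le hB))

end IsCollisionWeight

lemma measurable_generator {g f : ℝ → ℝ} (hg : Measurable g) (hf : Measurable f) (Vbar η : ℝ) :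
    Measurable (generator Vbar η g f) := by
  have hintegrand : Measurable fun z : ℝ × ℝ =>
      g z.2 * ((z.2 - z.1) * (f (kick Vbar η z.1 z.2) - f z.1)) :=
    (hg.comp measurable_snd).mul ((measurable_snd.sub measurable_fst).mul
      ((hf.comp (measurable_kick Vbar η)).sub (hf.comp measurable_fst)))
  exact hintegrand.stronglyMeasurable.integral_prod_right'.measurable

lemma generator_congr {vmin vmax Vbar η u : ℝ} {g f₁ f₂ : ℝ → ℝ}
    (G : IsCollisionWeight vmin vmax g) (H : IsHeavy vmin vmax Vbar η) (hu : |u| ≤ Vbar)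
    (hf : ∀ x, |x| ≤ Vbar → f₁ x = f₂ x) : generator Vbar η g f₁ u = generator Vbar η g f₂ u := by
  refine integral_congr_ae (.of_forall fun v => ?_)
  rcases le_or_gt vmax |v| with hv | hv
  · simp [G.cutoff v (Or.inr hv)]
  · simp only [hf u hu, hf _ (H.abs_kick_le hu hv.le)]

lemma abs_rate_mul_sub_le {vmin vmax Vbar η u v B : ℝ} {f : ℝ → ℝ}
    (H : IsHeavy vmin vmax Vbar η) (hu : |u| ≤ Vbar) (hfB : ∀ x, |x| ≤ Vbar → |f x| ≤ B)
    (hv : |v| ≤ vmax) :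
    |(v - u) * (f (kick Vbar η u v) - f u)| ≤ (vmax + Vbar) * (2 * B) := by
  rw [abs_mul, two_mul]
  exact mul_le_mul ((abs_sub _ _).trans (add_le_add hv hu))
    ((abs_sub _ _).trans (add_le_add (hfB _ (H.abs_kick_le hu hv)) (hfB u hu))) (abs_nonneg _)
    H.add_pos.le

lemma integrable_generator {vmin vmax Vbar η B : ℝ} {g f : ℝ → ℝ}
    (G : IsCollisionWeight vmin vmax g) (H : IsHeavy vmin vmax Vbar η) (hf : Measurable f)
    (hfB : ∀ x, |x| ≤ Vbar → |f x| ≤ B) {μ : Measure ℝ} [IsFiniteMeasure μ]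
    (hμ : ∀ᵐ u ∂μ, |u| ≤ Vbar) : Integrable (generator Vbar η g f) μ :=
  .of_bound (measurable_generator G.measurable hf Vbar η).aestronglyMeasurable _
    (hμ.mono fun _ hu => G.abs_integral_mul_le fun _ hv => abs_rate_mul_sub_le H hu hfB hv)

lemma integrable_kernel_integral_and_integral_eq {α : Type*} [MeasurableSpace α] {μ : Measure α}
    {κ : Kernel α α} (hinv : μ.bind κ = μ) {f : α → ℝ} (hf : Integrable f μ) :
    Integrable (fun u => ∫ x, f x ∂κ u) μ ∧ ∫ u, ∫ x, f x ∂κ u ∂μ = ∫ u, f u ∂μ := by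
  have hcomp : (κ ∘ₖ Kernel.const Unit μ) () = μ := by
    rw [Kernel.comp_apply, Kernel.const_apply, hinv]
  have hf' : Integrable f ((κ ∘ₖ Kernel.const Unit μ) ()) := by rwa [hcomp]
  refine ⟨by simpa using hf'.integral_comp, ?_⟩
  simpa [hinv] using (Kernel.integral_comp hf').symm

lemma integral_eq_zero_of_abs_kernel_integral_sub_le {α : Type*} [MeasurableSpace α]
    {μ : Measure α} [IsFiniteMeasure μ] {κ : ℝ → Kernel α α}
    (hinv : ∀ h, 0 < h → μ.bind (κ h) = μ) {f g : α → ℝ} (hf : Integrable f μ)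
    (hg : Integrable g μ) {C : ℝ}
    (hfg : ∀ h, 0 < h → ∀ᵐ u ∂μ, |(∫ x, f x ∂κ h u) - f u - h * g u| ≤ C * h ^ 2) :
    ∫ u, g u ∂μ = 0 := by
  have hbound : ∀ h, 0 < h → |∫ u, g u ∂μ| ≤ C * μ.real univ * h := by
    intro h hh
    obtain ⟨hκ, hκ'⟩ := integrable_kernel_integral_and_integral_eq (hinv h hh) hf
    have hint : ∫ u, ((∫ x, f x ∂κ h u) - f u - h * g u) ∂μ = -(h * ∫ u, g u ∂μ) := by
      rw [integral_sub (f := fun u => (∫ x, f x ∂κ h u) - f u) (hκ.sub hf) (hg.const_mul h),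
        integral_sub hκ hf, hκ', integral_const_mul]
      ring
    have hle := norm_integral_le_of_norm_le_const (μ := μ)
      (f := fun u => (∫ x, f x ∂κ h u) - f u - h * g u) (hfg h hh)
    rw [hint, norm_neg, norm_mul, Real.norm_eq_abs, Real.norm_eq_abs, abs_of_pos hh] at hle
    exact le_of_mul_le_mul_left (hle.trans_eq (by ring)) hh
  have hlim : Tendsto (fun h : ℝ => C * μ.real univ * h) (𝓝[>] 0) (𝓝 0) :=
    (Continuous.tendsto' (by fun_prop) 0 0 (mul_zero _)).mono_left nhdsWithin_le_nhds
  exact abs_nonpos_iff.1 (ge_of_tendsto hlim (eventually_nhdsWithin_of_forall hbound))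

/-- A probability measure on `[-Vbar, Vbar]` that annihilates the range of the generator. This is
all that the moment estimates use of a stationary measure. -/
structure IsGeneratorInvariant (Vbar η : ℝ) (g : ℝ → ℝ) (μ : Measure ℝ) : Prop where
  prob : IsProbabilityMeasure μ
  support : ∀ᵐ u ∂μ, |u| ≤ Vbar
  integral_generator : ∀ f : ℝ → ℝ, Continuous f → ∫ u, generator Vbar η g f u ∂μ = 0

namespace IsStationary

variable {vmin vmax Vbar m M : ℝ} {pminus pplus : ℝ → ℝ} {μ : Measure ℝ}

lemma integral_generator_of_bounded (hμ : IsStationary m M Vbar pminus pplus μ)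
    (hm : IsGasDensity vmin vmax pminus) (hp : IsGasDensity vmin vmax pplus) (hmM : M + m ≠ 0)
    (H : IsHeavy vmin vmax Vbar (2 * m / (M + m))) {B : ℝ} {f : ℝ → ℝ} (hf : Measurable f)
    (hfB : ∀ x, |f x| ≤ B) :
    ∫ u, generator Vbar (2 * m / (M + m)) (signedDensity pminus pplus) f u ∂μ = 0 := by
  have := hμ.prob
  have hsupp : ∀ᵐ u ∂μ, |u| ≤ Vbar := hμ.support.mono fun u hu => abs_le.2 hu
  obtain ⟨κ, hκ, hinv⟩ := hμ.invariant
  refine integral_eq_zero_of_abs_kernel_integral_sub_le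
    (C := 4 * B * (2 * (vmax + Vbar) * ∫ v, (pminus v + pplus v)) ^ 2)
    (fun h hh => hinv h hh.le) (.of_bound hf.aestronglyMeasurable B (.of_forall hfB))
    (integrable_generator (isCollisionWeight_signedDensity hm hp) H hf (fun x _ => hfB x) hsupp)
    fun h hh => hsupp.mono fun u hu => ?_
  obtain ⟨Ω, _, P, ξ, W, hP, hξ, hW, hE, hlaw⟩ := hκ u (abs_le.1 hu)
  rw [hlaw h hh.le, integral_map (hW h hh.le) hf.aestronglyMeasurable]
  exact abs_integral_sub_generator_le hm hp hmM H hu hh hf hfB hξ (hW h hh.le) hE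

theorem isGeneratorInvariant (hμ : IsStationary m M Vbar pminus pplus μ)
    (hm : IsGasDensity vmin vmax pminus) (hp : IsGasDensity vmin vmax pplus) (hmM : M + m ≠ 0)
    (H : IsHeavy vmin vmax Vbar (2 * m / (M + m))) :
    IsGeneratorInvariant Vbar (2 * m / (M + m)) (signedDensity pminus pplus) μ where
  prob := hμ.prob
  support := hμ.support.mono fun u hu => abs_le.2 hu
  integral_generator f hf := by
    have hV : -Vbar ≤ Vbar := by linarith [H.Vbar_pos]
    obtain ⟨B, hB⟩ := exists_abs_le_of_continuous hf Vbar
    have hcont : Continuous fun x => f (projIcc (-Vbar) Vbar hV x) :=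
      hf.comp (continuous_subtype_val.comp continuous_projIcc)
    rw [← hμ.integral_generator_of_bounded hm hp hmM H hcont.measurable
      fun x => hB _ (abs_le.2 (projIcc (-Vbar) Vbar hV x).2)]
    refine integral_congr_ae (hμ.support.mono fun u hu => ?_)
    exact generator_congr (isCollisionWeight_signedDensity hm hp) H (abs_le.2 hu)
      fun x hx => by rw [projIcc_of_mem hV (abs_le.1 hx)]

end IsStationary

/-! ### Moments of the collision weight -/

/-- For `g = signedDensity pminus pplus` this is `Q_k`. -/
noncomputable def weightMoment (g : ℝ → ℝ) (k : ℕ) : ℝ := ∫ v, g v * v ^ k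

/-- The moments of the velocities of the atoms relative to a piston of velocity `u`; in particular
`η * relativeMoment g 2 u` is the drift of the piston. -/
noncomputable def relativeMoment (g : ℝ → ℝ) (j : ℕ) (u : ℝ) : ℝ := ∫ v, g v * (v - u) ^ j

section Q

variable {vmin vmax : ℝ} {pminus pplus : ℝ → ℝ}

lemma Fminus_eq_setIntegral_Ioi (hvmin : 0 < vmin) (hv : vmin < vmax)
    (hm : IsGasDensity vmin vmax pminus) (k : ℕ) :
    Fminus vmin vmax pminus k = ∫ v in Ioi 0, v ^ k * pminus v := by
  rw [Fminus, intervalIntegral.integral_of_le hv.le]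
  refine (setIntegral_eq_of_subset_of_forall_sdiff_eq_zero measurableSet_Ioi
    (fun v hv => hvmin.trans hv.1) fun v hv => ?_).symm
  have hv0 : 0 < v := hv.1
  rw [hm.cutoff v, mul_zero]
  by_contra! hcut
  rw [abs_of_pos hv0] at hcut
  exact hv.2 ⟨hcut.1, hcut.2.le⟩

lemma Fplus_eq_setIntegral_Iic (hvmin : 0 < vmin) (hv : vmin < vmax)
    (hp : IsGasDensity vmin vmax pplus) (k : ℕ) :
    Fplus vmin vmax pplus k = ∫ v in Iic 0, v ^ k * pplus v := by
  rw [Fplus, intervalIntegral.integral_of_le (by linarith)]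
  refine (setIntegral_eq_of_subset_of_forall_sdiff_eq_zero measurableSet_Iic
    (fun v hv => hv.2.trans (by linarith)) fun v hv => ?_).symm
  have hv0 : v ≤ 0 := hv.1
  rw [hp.cutoff v, mul_zero]
  by_contra! hcut
  rw [abs_of_nonpos hv0] at hcut
  exact hv.2 ⟨by linarith, by linarith⟩

lemma Q_eq_weightMoment (hvmin : 0 < vmin) (hv : vmin < vmax)
    (hm : IsGasDensity vmin vmax pminus) (hp : IsGasDensity vmin vmax pplus) (k : ℕ) :
    Q vmin vmax pminus pplus k = weightMoment (signedDensity pminus pplus) k := by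
  have hint := (isCollisionWeight_signedDensity hm hp).integrable_mul_of_continuous
    (continuous_pow k)
  rw [Q, Fminus_eq_setIntegral_Ioi hvmin hv hm, Fplus_eq_setIntegral_Iic hvmin hv hp,
    weightMoment, ← intervalIntegral.integral_Iic_add_Ioi (b := 0) hint.integrableOn
      hint.integrableOn, ← neg_add_eq_sub, ← integral_neg]
  congr 1
  · refine setIntegral_congr_fun measurableSet_Iic fun v hv => ?_
    simp only [signedDensity, if_neg (not_lt.2 (mem_Iic.1 hv))]
    ring
  · refine setIntegral_congr_fun measurableSet_Ioi fun v hv => ?_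
    simp only [signedDensity, if_pos (mem_Ioi.1 hv)]
    ring

end Q

namespace IsCollisionWeight

variable {vmin vmax : ℝ} {g : ℝ → ℝ} (G : IsCollisionWeight vmin vmax g)
include G

lemma mul_sub_nonneg {u : ℝ} (hu : |u| ≤ vmin) (v : ℝ) : 0 ≤ g v * (v - u) := by
  rcases le_or_gt |v| vmin with hv | hv
  · simp [G.cutoff v (Or.inl hv)]
  · rw [abs_le] at hu
    rcases lt_abs.1 hv with h | h
    · exact mul_nonneg (nonneg_of_mul_nonneg_left (G.sign v) (by linarith)) (by linarith)
    · exact mul_nonneg_of_nonpos_of_nonpos (nonpos_of_mul_nonneg_left (G.sign v) (by linarith))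
        (by linarith)

lemma abs_mul_vmin_le (v : ℝ) : |g v| * vmin ≤ g v * v := by
  rcases le_or_gt |v| vmin with hv | hv
  · simp [G.cutoff v (Or.inl hv)]
  · rw [← abs_of_nonneg (G.sign v), abs_mul]
    exact mul_le_mul_of_nonneg_left hv.le (abs_nonneg _)

lemma integral_abs_mul_vmin_le : (∫ v, |g v|) * vmin ≤ weightMoment g 1 := by
  rw [weightMoment, ← integral_mul_const]
  exact integral_mono (G.integrable.abs.mul_const _)
    (G.integrable_mul_of_continuous (continuous_pow 1)) fun v =>
      (G.abs_mul_vmin_le v).trans_eq (by rw [pow_one])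

lemma weightMoment_one_pos (hvmin : 0 < vmin) : 0 < weightMoment g 1 :=
  (mul_pos G.pos hvmin).trans_le G.integral_abs_mul_vmin_le

lemma abs_weightMoment_zero_mul_le (hvmin : 0 ≤ vmin) :
    |weightMoment g 0| * vmin ≤ weightMoment g 1 := by
  refine (mul_le_mul_of_nonneg_right ?_ hvmin).trans G.integral_abs_mul_vmin_le
  simpa [weightMoment] using abs_integral_le_integral_abs (f := g) (μ := volume)

lemma integrable_mul_sub_pow (j : ℕ) (u : ℝ) : Integrable fun v => g v * (v - u) ^ j :=
  G.integrable_mul_of_continuous (by fun_prop)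

lemma relativeMoment_eq_sum (j : ℕ) (u : ℝ) :
    relativeMoment g j u =
      ∑ k ∈ Finset.range (j + 1), (-u) ^ (j - k) * j.choose k * weightMoment g k := by
  simp only [relativeMoment, weightMoment, ← integral_const_mul]
  rw [← integral_finsetSum _ fun k _ =>
    (G.integrable_mul_of_continuous (continuous_pow k)).const_mul _]
  refine integral_congr_ae (.of_forall fun v => ?_)
  simp only [sub_eq_add_neg, add_pow, Finset.mul_sum]
  exact Finset.sum_congr rfl fun k _ => by ring

lemma relativeMoment_two (u : ℝ) :
    relativeMoment g 2 u =
      weightMoment g 2 - 2 * weightMoment g 1 * u + weightMoment g 0 * u ^ 2 := by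
  rw [G.relativeMoment_eq_sum]
  simp only [Finset.sum_range_succ, Finset.range_zero, Finset.sum_empty, Nat.choose]
  norm_num
  ring

lemma relativeMoment_three (u : ℝ) :
    relativeMoment g 3 u = weightMoment g 3 - 3 * weightMoment g 2 * u +
      3 * weightMoment g 1 * u ^ 2 - weightMoment g 0 * u ^ 3 := by
  rw [G.relativeMoment_eq_sum]
  simp only [Finset.sum_range_succ, Finset.range_zero, Finset.sum_empty, Nat.choose]
  norm_num
  ring

lemma continuous_relativeMoment (j : ℕ) : Continuous (relativeMoment g j) := by
  simp only [funext (G.relativeMoment_eq_sum j)]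
  fun_prop

lemma abs_relativeMoment_le (j : ℕ) {u V : ℝ} (hu : |u| ≤ V) :
    |relativeMoment g j u| ≤ (∫ v, |g v|) * (vmax + V) ^ j :=
  G.abs_integral_mul_le fun v hv => by
    rw [abs_pow]
    exact pow_le_pow_left₀ (abs_nonneg _) ((abs_sub v u).trans (add_le_add hv hu)) j

end IsCollisionWeight

/-! ### Concentration of the invariant measure -/

lemma abs_reflect_le_abs {Vbar V : ℝ} (h : |V| ≤ 3 * Vbar) : |reflect Vbar V| ≤ |V| := by
  have hle := le_abs_self V
  have hge := neg_abs_le V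
  unfold reflect
  split_ifs
  · exact abs_le.2 ⟨by linarith, by linarith⟩
  · exact abs_le.2 ⟨by linarith, by linarith⟩
  · exact le_rfl

/-- The exponents `a` for which `exp (a * u ^ 2 / η)` is a Lyapunov function of the velocity
process. -/
structure IsLyapunovExponent (vmax Vbar : ℝ) (g : ℝ → ℝ) (a : ℝ) : Prop where
  pos : 0 < a
  jump_le : 3 * a * (vmax + Vbar) ^ 2 ≤ 1
  quadratic_le : 8 * a * (vmax + Vbar) ^ 3 * (∫ v, |g v|) ≤ weightMoment g 1

lemma IsCollisionWeight.exists_isLyapunovExponent {vmin vmax Vbar : ℝ} {g : ℝ → ℝ}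
    (G : IsCollisionWeight vmin vmax g) (hvmin : 0 < vmin) (hK : 0 < vmax + Vbar) :
    ∃ a, IsLyapunovExponent vmax Vbar g a := by
  have hA := G.pos
  have hQ₁ := G.weightMoment_one_pos hvmin
  refine ⟨min (1 / (3 * (vmax + Vbar) ^ 2))
    (weightMoment g 1 / (8 * (vmax + Vbar) ^ 3 * ∫ v, |g v|)), by positivity, ?_, ?_⟩
  · have hle := (le_div_iff₀ (by positivity)).1 (min_le_left (1 / (3 * (vmax + Vbar) ^ 2))
      (weightMoment g 1 / (8 * (vmax + Vbar) ^ 3 * ∫ v, |g v|)))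
    linarith
  · have hle := (le_div_iff₀ (by positivity)).1 (min_le_right (1 / (3 * (vmax + Vbar) ^ 2))
      (weightMoment g 1 / (8 * (vmax + Vbar) ^ 3 * ∫ v, |g v|)))
    linarith

section Lyapunov

variable {vmin vmax Vbar η a u v : ℝ} {g : ℝ → ℝ}

lemma IsHeavy.le_one (H : IsHeavy vmin vmax Vbar η) : η ≤ 1 := by
  by_contra! h
  nlinarith [H.small_kick, H.vmin_pos, H.vmin_lt, H.Vbar_pos]

lemma IsLyapunovExponent.abs_mul_le_one (La : IsLyapunovExponent vmax Vbar g a)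
    (H : IsHeavy vmin vmax Vbar η) (hu : |u| ≤ Vbar) (hv : |v| ≤ vmax) :
    |a * (2 * u * (v - u) + η * (v - u) ^ 2)| ≤ 1 := by
  have hK : |v - u| ≤ vmax + Vbar := (abs_sub v u).trans (add_le_add hv hu)
  have hu' : |u| ≤ vmax + Vbar := by linarith [H.vmin_pos, H.vmin_lt]
  have hfactor : |2 * u + η * (v - u)| ≤ 3 * (vmax + Vbar) :=
    calc |2 * u + η * (v - u)| ≤ 2 * |u| + η * |v - u| := by
          simpa [abs_mul, abs_of_pos H.pos] using abs_add_le (2 * u) (η * (v - u))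
      _ ≤ 2 * (vmax + Vbar) + 1 * (vmax + Vbar) :=
          add_le_add (by linarith) (mul_le_mul H.le_one hK (abs_nonneg _) zero_le_one)
      _ = 3 * (vmax + Vbar) := by ring
  calc |a * (2 * u * (v - u) + η * (v - u) ^ 2)| = a * (|2 * u + η * (v - u)| * |v - u|) := by
        rw [← abs_mul, ← abs_of_pos La.pos, ← abs_mul, abs_of_pos La.pos]
        ring_nf
    _ ≤ a * (3 * (vmax + Vbar) * (vmax + Vbar)) :=
        mul_le_mul_of_nonneg_left (mul_le_mul hfactor hK (abs_nonneg _)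
          (by linarith [H.add_pos])) La.pos.le
    _ ≤ 1 := by linarith [La.jump_le]

lemma IsLyapunovExponent.exp_kick_sub_le (La : IsLyapunovExponent vmax Vbar g a)
    (H : IsHeavy vmin vmax Vbar η) (hu : |u| ≤ Vbar) (hv : |v| ≤ vmax) :
    Real.exp (a / η * kick Vbar η u v ^ 2) - Real.exp (a / η * u ^ 2) ≤
      Real.exp (a / η * u ^ 2) * (a * (2 * u * (v - u) + η * (v - u) ^ 2) +
        a ^ 2 * (8 * u ^ 2 * (v - u) ^ 2 + 2 * η ^ 2 * (v - u) ^ 4)) := by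
  have hη := H.pos
  have ha := La.pos
  set x := a * (2 * u * (v - u) + η * (v - u) ^ 2) with hx
  have hkick : kick Vbar η u v ^ 2 ≤ (u + η * (v - u)) ^ 2 :=
    sq_le_sq.2 (abs_reflect_le_abs ((abs_add_le _ _).trans
      (by linarith [H.abs_mul_sub_le hu hv, H.Vbar_pos])))
  have hexp : Real.exp (a / η * kick Vbar η u v ^ 2) ≤
      Real.exp (a / η * u ^ 2) * Real.exp x := by
    rw [← Real.exp_add, show a / η * u ^ 2 + x = a / η * (u + η * (v - u)) ^ 2 by
      rw [hx]; field_simp; ring]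
    exact Real.exp_le_exp.2 (mul_le_mul_of_nonneg_left hkick (by positivity))
  have htaylor : Real.exp x - 1 ≤ x + x ^ 2 := by
    linarith [(abs_le.1 (Real.abs_exp_sub_one_sub_id_le (La.abs_mul_le_one H hu hv))).2]
  have hsq : x ^ 2 ≤ a ^ 2 * (8 * u ^ 2 * (v - u) ^ 2 + 2 * η ^ 2 * (v - u) ^ 4) := by
    rw [hx, mul_pow]
    refine mul_le_mul_of_nonneg_left ?_ (sq_nonneg a)
    linarith [add_sq_le (a := 2 * u * (v - u)) (b := η * (v - u) ^ 2)]
  linarith [mul_le_mul_of_nonneg_left (htaylor.trans (add_le_add_right hsq x))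
    (Real.exp_pos (a / η * u ^ 2)).le]

lemma IsLyapunovExponent.generator_exp_le_relativeMoment (La : IsLyapunovExponent vmax Vbar g a)
    (G : IsCollisionWeight vmin vmax g) (H : IsHeavy vmin vmax Vbar η) (hu : |u| ≤ Vbar) :
    generator Vbar η g (fun w => Real.exp (a / η * w ^ 2)) u ≤
      Real.exp (a / η * u ^ 2) *
        (a * (2 * u * relativeMoment g 2 u + η * relativeMoment g 3 u) +
          a ^ 2 * (8 * u ^ 2 * relativeMoment g 3 u + 2 * η ^ 2 * relativeMoment g 5 u)) := by
  obtain ⟨B, hB⟩ := exists_abs_le_of_continuous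
    (by fun_prop : Continuous fun w => Real.exp (a / η * w ^ 2)) Vbar
  have hR := fun j c => (G.integrable_mul_sub_pow j u).const_mul c
  have hR₂₃ : Integrable fun v => 2 * u * (g v * (v - u) ^ 2) + η * (g v * (v - u) ^ 3) :=
    (hR 2 _).add (hR 3 _)
  have hR₃₅ : Integrable fun v =>
      8 * u ^ 2 * (g v * (v - u) ^ 3) + 2 * η ^ 2 * (g v * (v - u) ^ 5) :=
    (hR 3 _).add (hR 5 _)
  have hintegral : ∫ v, (a * (2 * u * (g v * (v - u) ^ 2) + η * (g v * (v - u) ^ 3)) +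
      a ^ 2 * (8 * u ^ 2 * (g v * (v - u) ^ 3) + 2 * η ^ 2 * (g v * (v - u) ^ 5))) =
      a * (2 * u * relativeMoment g 2 u + η * relativeMoment g 3 u) +
        a ^ 2 * (8 * u ^ 2 * relativeMoment g 3 u + 2 * η ^ 2 * relativeMoment g 5 u) := by
    rw [integral_add (hR₂₃.const_mul a) (hR₃₅.const_mul (a ^ 2)), integral_const_mul a,
      integral_const_mul (a ^ 2), integral_add (hR 2 _) (hR 3 _), integral_add (hR 3 _) (hR 5 _)]
    simp only [integral_const_mul, relativeMoment]
  rw [← hintegral, ← integral_const_mul]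
  refine integral_mono (G.integrable_mul ?_ fun v hv => abs_rate_mul_sub_le H hu hB hv)
    (((hR₂₃.const_mul a).add (hR₃₅.const_mul (a ^ 2))).const_mul _) fun v => ?_
  · exact (measurable_id.sub_const u).mul (((by fun_prop :
      Measurable fun w => Real.exp (a / η * w ^ 2)).comp ((measurable_kick Vbar η).comp
        (by fun_prop : Measurable fun v : ℝ => (u, v)))).sub_const _)
  rcases le_or_gt vmax |v| with hv | hv
  · simp [G.cutoff v (Or.inr hv)]
  · have hu' : |u| ≤ vmin := by linarith [H.Vbar_lt, H.Vbar_pos]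
    have hle := mul_le_mul_of_nonneg_left (La.exp_kick_sub_le H hu hv.le)
      (G.mul_sub_nonneg hu' v)
    linarith

lemma IsCollisionWeight.mul_relativeMoment_two_le (G : IsCollisionWeight vmin vmax g)
    (hvmin : 0 < vmin) (hQ₂ : weightMoment g 2 = 0) (hu : 3 * |u| ≤ vmin) :
    2 * u * relativeMoment g 2 u ≤ -3 * weightMoment g 1 * u ^ 2 := by
  have hQ₀ : weightMoment g 0 * u ≤ weightMoment g 1 / 3 :=
    calc weightMoment g 0 * u ≤ |weightMoment g 0| * |u| := (le_abs_self _).trans_eq (abs_mul _ _)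
      _ ≤ |weightMoment g 0| * (vmin / 3) :=
          mul_le_mul_of_nonneg_left (by linarith) (abs_nonneg _)
      _ ≤ weightMoment g 1 / 3 := by linarith [G.abs_weightMoment_zero_mul_le hvmin.le]
  rw [G.relativeMoment_two, hQ₂]
  linarith [mul_le_mul_of_nonneg_right hQ₀ (sq_nonneg u),
    mul_nonneg (G.weightMoment_one_pos hvmin).le (sq_nonneg u)]

lemma IsLyapunovExponent.generator_exp_le (La : IsLyapunovExponent vmax Vbar g a)
    (G : IsCollisionWeight vmin vmax g) (H : IsHeavy vmin vmax Vbar η)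
    (hQ₂ : weightMoment g 2 = 0) (hu : |u| ≤ Vbar) :
    generator Vbar η g (fun w => Real.exp (a / η * w ^ 2)) u ≤
      a * (Real.exp (a / η * u ^ 2) *
        (2 * (∫ v, |g v|) * (vmax + Vbar) ^ 3 * η - 2 * weightMoment g 1 * u ^ 2)) := by
  have hη := H.pos
  have ha := La.pos
  have hK := H.add_pos
  have hA := G.pos
  have hdrift := G.mul_relativeMoment_two_le H.vmin_pos hQ₂ (by linarith [H.Vbar_lt] :
    3 * |u| ≤ vmin)
  have hR₃ := (le_abs_self _).trans (G.abs_relativeMoment_le 3 hu)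
  have hR₅ := (le_abs_self _).trans (G.abs_relativeMoment_le 5 hu)
  have hquad : 8 * a * u ^ 2 * relativeMoment g 3 u ≤ weightMoment g 1 * u ^ 2 :=
    calc 8 * a * u ^ 2 * relativeMoment g 3 u
        ≤ 8 * a * u ^ 2 * ((∫ v, |g v|) * (vmax + Vbar) ^ 3) :=
          mul_le_mul_of_nonneg_left hR₃ (by positivity)
      _ = 8 * a * (vmax + Vbar) ^ 3 * (∫ v, |g v|) * u ^ 2 := by ring
      _ ≤ weightMoment g 1 * u ^ 2 := mul_le_mul_of_nonneg_right La.quadratic_le (sq_nonneg u)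
  have hquart : 2 * a * η ^ 2 * relativeMoment g 5 u ≤ (∫ v, |g v|) * (vmax + Vbar) ^ 3 * η :=
    calc 2 * a * η ^ 2 * relativeMoment g 5 u
        ≤ 2 * a * η ^ 2 * ((∫ v, |g v|) * (vmax + Vbar) ^ 5) :=
          mul_le_mul_of_nonneg_left hR₅ (by positivity)
      _ = 2 * (a * (vmax + Vbar) ^ 2) * η * ((∫ v, |g v|) * (vmax + Vbar) ^ 3 * η) := by ring
      _ ≤ 2 * (1 / 3) * 1 * ((∫ v, |g v|) * (vmax + Vbar) ^ 3 * η) := by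
          gcongr
          exacts [by linarith [La.jump_le], H.le_one]
      _ ≤ (∫ v, |g v|) * (vmax + Vbar) ^ 3 * η := by
          linarith [mul_pos (mul_pos hA (pow_pos hK 3)) hη]
  refine (La.generator_exp_le_relativeMoment G H hu).trans ?_
  have hfactor : 2 * u * relativeMoment g 2 u + η * relativeMoment g 3 u +
      a * (8 * u ^ 2 * relativeMoment g 3 u + 2 * η ^ 2 * relativeMoment g 5 u) ≤
      2 * (∫ v, |g v|) * (vmax + Vbar) ^ 3 * η - 2 * weightMoment g 1 * u ^ 2 := by
    linarith [mul_le_mul_of_nonneg_left hR₃ hη.le]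
  refine le_trans (le_of_eq ?_) (mul_le_mul_of_nonneg_left
    (mul_le_mul_of_nonneg_left hfactor (Real.exp_pos (a / η * u ^ 2)).le) ha.le)
  ring

end Lyapunov

lemma exp_mul_sub_le {a b q η u : ℝ} (ha : 0 ≤ a) (hb : 0 ≤ b) (hq : 0 < q) (hη : 0 < η) :
    Real.exp (a / η * u ^ 2) * (b * η - q * u ^ 2) ≤ Real.exp (a * b / q) * (b * η) := by
  rcases le_or_gt (b * η) (q * u ^ 2) with h | h
  · exact (mul_nonpos_of_nonneg_of_nonpos (Real.exp_pos _).le (by linarith)).trans (by positivity)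
  · have hexponent : a / η * u ^ 2 ≤ a * b / q := by
      rw [div_mul_eq_mul_div, div_le_div_iff₀ hη hq]
      linarith [mul_le_mul_of_nonneg_left h.le ha]
    refine mul_le_mul (Real.exp_le_exp.2 hexponent) ?_ (by linarith) (Real.exp_pos _).le
    linarith [mul_nonneg hq.le (sq_nonneg u)]

namespace IsGeneratorInvariant

variable {vmin vmax Vbar η a : ℝ} {g : ℝ → ℝ} {μ : Measure ℝ}

lemma integrable (hμ : IsGeneratorInvariant Vbar η g μ) {f : ℝ → ℝ} (hf : Continuous f) :
    Integrable f μ := by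
  have := hμ.prob
  obtain ⟨B, hB⟩ := exists_abs_le_of_continuous hf Vbar
  exact .of_bound hf.aestronglyMeasurable B (hμ.support.mono hB)

lemma integral_exp_le (hμ : IsGeneratorInvariant Vbar η g μ)
    (La : IsLyapunovExponent vmax Vbar g a) (G : IsCollisionWeight vmin vmax g)
    (H : IsHeavy vmin vmax Vbar η) (hQ₂ : weightMoment g 2 = 0) :
    ∫ u, Real.exp (a / η * u ^ 2) ∂μ ≤
      2 * Real.exp (a * (2 * (∫ v, |g v|) * (vmax + Vbar) ^ 3) / weightMoment g 1) := by
  have := hμ.prob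
  have hη := H.pos
  have hK := H.add_pos
  have hA := G.pos
  set b := 2 * (∫ v, |g v|) * (vmax + Vbar) ^ 3
  set q := weightMoment g 1
  have hb : 0 < b := by positivity
  have hdrift : 0 ≤ ∫ u, Real.exp (a / η * u ^ 2) * (b * η - 2 * q * u ^ 2) ∂μ := by
    refine nonneg_of_mul_nonneg_right (a := a) ?_ La.pos
    obtain ⟨B, hB⟩ := exists_abs_le_of_continuous
      (by fun_prop : Continuous fun w => Real.exp (a / η * w ^ 2)) Vbar
    rw [← integral_const_mul, ← hμ.integral_generator _
      (by fun_prop : Continuous fun w => Real.exp (a / η * w ^ 2))]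
    exact integral_mono_ae (integrable_generator G H (by fun_prop) hB hμ.support)
      (hμ.integrable (by fun_prop)) (hμ.support.mono fun u hu => La.generator_exp_le G H hQ₂ hu)
  have hle : ∫ u, (b * η) * Real.exp (a / η * u ^ 2) ∂μ ≤
      ∫ u, (2 * (Real.exp (a * b / q) * (b * η)) -
        Real.exp (a / η * u ^ 2) * (b * η - 2 * q * u ^ 2)) ∂μ :=
    integral_mono (hμ.integrable (by fun_prop)) (hμ.integrable (by fun_prop)) fun u => by
      linarith [exp_mul_sub_le La.pos.le hb.le (G.weightMoment_one_pos H.vmin_pos) hη (u := u)]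
  rw [integral_const_mul, integral_sub (integrable_const _) (hμ.integrable (by fun_prop)),
    integral_const, probReal_univ, one_smul] at hle
  exact le_of_mul_le_mul_left (by linarith) (mul_pos hb hη)

end IsGeneratorInvariant

/-! ### The reflection is negligible -/

/-- The generator of the velocity process without reflection at `±Vbar`. -/
noncomputable def freeGenerator (η : ℝ) (g f : ℝ → ℝ) (u : ℝ) : ℝ :=
  ∫ v, g v * ((v - u) * (f (u + η * (v - u)) - f u))

lemma measurable_freeGenerator {g f : ℝ → ℝ} (hg : Measurable g) (hf : Measurable f) (η : ℝ) :
    Measurable (freeGenerator η g f) := by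
  have hintegrand : Measurable fun z : ℝ × ℝ =>
      g z.2 * ((z.2 - z.1) * (f (z.1 + η * (z.2 - z.1)) - f z.1)) := by fun_prop
  exact hintegrand.stronglyMeasurable.integral_prod_right'.measurable

lemma IsCollisionWeight.freeGenerator_pow {vmin vmax : ℝ} {g : ℝ → ℝ}
    (G : IsCollisionWeight vmin vmax g) (η : ℝ) (n : ℕ) (u : ℝ) :
    freeGenerator η g (fun w => w ^ n) u =
      ∑ j ∈ Finset.range n,
        n.choose (j + 1) * u ^ (n - (j + 1)) * η ^ (j + 1) * relativeMoment g (j + 2) u := by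
  simp only [freeGenerator, relativeMoment, ← integral_const_mul]
  rw [← integral_finsetSum _ fun j _ => (G.integrable_mul_sub_pow _ u).const_mul _]
  refine integral_congr_ae (.of_forall fun v => ?_)
  simp only [add_comm u, add_pow, Finset.sum_range_succ' _ n, pow_zero, Nat.choose_zero_right,
    Nat.sub_zero, one_mul, Nat.cast_one, mul_one, add_sub_cancel_right, mul_pow, Finset.mul_sum]
  exact Finset.sum_congr rfl fun j _ => by ring

lemma abs_reflect_sub_le {Vbar u d : ℝ} (hu : |u| ≤ Vbar) :
    |reflect Vbar (u + d) - (u + d)| ≤ 2 * |d| := by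
  obtain ⟨hul, hur⟩ := abs_le.1 hu
  have hle := le_abs_self d
  have hge := neg_abs_le d
  unfold reflect
  split_ifs
  · exact abs_le.2 ⟨by linarith, by linarith⟩
  · exact abs_le.2 ⟨by linarith, by linarith⟩
  · simp

lemma reflect_eq_self {Vbar V : ℝ} (hV : |V| ≤ Vbar) : reflect Vbar V = V := by
  rw [reflect, if_neg (abs_le.1 hV).2.not_gt, if_neg (abs_le.1 hV).1.not_gt]

section Reflection

variable {vmin vmax Vbar η a u v : ℝ} {g f : ℝ → ℝ} {L : ℝ≥0}

/-- The reflection acts only if `Vbar / 2 < |u|`, and then the product of the exponentials is at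
least `1`. -/
lemma IsHeavy.abs_kick_sub_le (H : IsHeavy vmin vmax Vbar η) (ha : 0 ≤ a) (hu : |u| ≤ Vbar)
    (hv : |v| ≤ vmax) :
    |kick Vbar η u v - (u + η * (v - u))| ≤ 2 * (vmax + Vbar) * η *
      (Real.exp (-(a * Vbar ^ 2 / 4) / η) * Real.exp (a / η * u ^ 2)) := by
  have hη := H.pos
  have hK := H.add_pos
  rcases le_or_gt |u| (Vbar / 2) with hnear | hfar
  · rw [kick, reflect_eq_self ((abs_add_le _ _).trans
      (by linarith [H.abs_mul_sub_le hu hv])), sub_self, abs_zero]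
    positivity
  · have hexp : 1 ≤ Real.exp (-(a * Vbar ^ 2 / 4) / η) * Real.exp (a / η * u ^ 2) := by
      rw [← Real.exp_add, show -(a * Vbar ^ 2 / 4) / η + a / η * u ^ 2 =
        a / η * (|u| ^ 2 - (Vbar / 2) ^ 2) by rw [sq_abs]; ring]
      exact Real.one_le_exp (mul_nonneg (by positivity)
        (sub_nonneg.2 (pow_le_pow_left₀ (by linarith [H.Vbar_pos]) hfar.le 2)))
    calc |kick Vbar η u v - (u + η * (v - u))| ≤ 2 * |η * (v - u)| := abs_reflect_sub_le hu
      _ = 2 * |v - u| * η := by rw [abs_mul, abs_of_pos hη]; ring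
      _ ≤ 2 * (vmax + Vbar) * η := by gcongr; exact (abs_sub v u).trans (add_le_add hv hu)
      _ ≤ _ := le_mul_of_one_le_right (by positivity) hexp

lemma abs_generator_sub_freeGenerator_le (G : IsCollisionWeight vmin vmax g)
    (H : IsHeavy vmin vmax Vbar η) (hf : Continuous f)
    (hL : LipschitzOnWith L f (Icc (-(2 * Vbar)) (2 * Vbar))) (ha : 0 ≤ a) (hu : |u| ≤ Vbar) :
    |generator Vbar η g f u - freeGenerator η g f u| ≤
      (∫ v, |g v|) * ((vmax + Vbar) * (L * (2 * (vmax + Vbar) * η *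
        (Real.exp (-(a * Vbar ^ 2 / 4) / η) * Real.exp (a / η * u ^ 2))))) := by
  obtain ⟨B, hB⟩ := exists_abs_le_of_continuous hf Vbar
  have hkick : Measurable fun v => (v - u) * (f (kick Vbar η u v) - f u) :=
    (measurable_id.sub_const u).mul ((hf.measurable.comp ((measurable_kick Vbar η).comp
      (by fun_prop : Measurable fun v : ℝ => (u, v)))).sub_const _)
  rw [generator, freeGenerator, ← integral_sub
    (G.integrable_mul hkick fun v hv => abs_rate_mul_sub_le H hu hB hv)
    (G.integrable_mul_of_continuous (by fun_prop))]
  simp only [← mul_sub, sub_sub_sub_cancel_right]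
  refine G.abs_integral_mul_le fun v hv => ?_
  have hkick_mem : kick Vbar η u v ∈ Icc (-(2 * Vbar)) (2 * Vbar) :=
    abs_le.1 ((H.abs_kick_le hu hv).trans (by linarith [H.Vbar_pos]))
  have hfree_mem : u + η * (v - u) ∈ Icc (-(2 * Vbar)) (2 * Vbar) :=
    abs_le.1 ((abs_add_le _ _).trans (by linarith [H.abs_mul_sub_le hu hv, H.Vbar_pos]))
  rw [abs_mul]
  refine mul_le_mul ((abs_sub v u).trans (add_le_add hv hu)) ?_ (abs_nonneg _) H.add_pos.le
  refine (hL.dist_le_mul _ hkick_mem _ hfree_mem).trans ?_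
  exact mul_le_mul_of_nonneg_left (H.abs_kick_sub_le ha hu hv) L.coe_nonneg

lemma IsGeneratorInvariant.abs_integral_freeGenerator_le {μ : Measure ℝ}
    (hμ : IsGeneratorInvariant Vbar η g μ) (G : IsCollisionWeight vmin vmax g)
    (H : IsHeavy vmin vmax Vbar η) (hf : Continuous f)
    (hL : LipschitzOnWith L f (Icc (-(2 * Vbar)) (2 * Vbar))) (ha : 0 ≤ a) :
    |∫ u, freeGenerator η g f u ∂μ| ≤
      2 * (∫ v, |g v|) * (vmax + Vbar) ^ 2 * L * (∫ u, Real.exp (a / η * u ^ 2) ∂μ) *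
        (η * Real.exp (-(a * Vbar ^ 2 / 4) / η)) := by
  have := hμ.prob
  obtain ⟨B, hB⟩ := exists_abs_le_of_continuous hf Vbar
  have hgen := integrable_generator G H hf.measurable hB hμ.support
  have hbound := hμ.support.mono fun u hu => abs_generator_sub_freeGenerator_le G H hf hL ha hu
  have hbound_int : Integrable (fun u => (∫ v, |g v|) * ((vmax + Vbar) * (L *
      (2 * (vmax + Vbar) * η * (Real.exp (-(a * Vbar ^ 2 / 4) / η) *
        Real.exp (a / η * u ^ 2)))))) μ := hμ.integrable (by fun_prop)
  have hdiff := hbound_int.mono' ((measurable_generator G.measurable hf.measurable Vbar η).sub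
    (measurable_freeGenerator G.measurable hf.measurable η)).aestronglyMeasurable hbound
  have hfree : Integrable (freeGenerator η g f) μ :=
    (hgen.sub hdiff).congr (.of_forall fun u => sub_sub_cancel _ _)
  have hneg := integral_sub hgen hfree
  rw [hμ.integral_generator f hf, zero_sub] at hneg
  rw [← abs_neg, ← hneg]
  refine (norm_integral_le_of_norm_le
    (f := fun u => generator Vbar η g f u - freeGenerator η g f u) hbound_int hbound).trans_eq ?_
  simp only [integral_const_mul]
  ring

end Reflection

/-! ### Moment equations -/

namespace IsGeneratorInvariant

variable {vmin vmax Vbar η : ℝ} {g : ℝ → ℝ} {μ : Measure ℝ} (hμ : IsGeneratorInvariant Vbar η g μ)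
  (G : IsCollisionWeight vmin vmax g)
include hμ G

lemma integral_freeGenerator_id :
    ∫ u, freeGenerator η g (fun w => w) u ∂μ =
      η * (weightMoment g 2 - 2 * weightMoment g 1 * (∫ u, u ∂μ) +
        weightMoment g 0 * (∫ u, u ^ 2 ∂μ)) := by
  have := hμ.prob
  have hfree : freeGenerator η g (fun w => w) = fun u => η *
      (weightMoment g 2 - 2 * weightMoment g 1 * u + weightMoment g 0 * u ^ 2) := by
    ext u
    simpa [G.relativeMoment_two] using G.freeGenerator_pow η 1 u
  rw [hfree, integral_const_mul, integral_add, integral_sub,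
    integral_const_mul (2 * weightMoment g 1)]
  · simp only [integral_const_mul, integral_const, probReal_univ, one_smul]
  all_goals exact hμ.integrable (by fun_prop)

lemma integral_freeGenerator_sq (hQ₂ : weightMoment g 2 = 0) :
    ∫ u, freeGenerator η g (fun w => w ^ 2) u ∂μ =
      -2 * η * (2 * weightMoment g 1 * (∫ u, u ^ 2 ∂μ) - weightMoment g 0 * (∫ u, u ^ 3 ∂μ) -
        η / 2 * (weightMoment g 3 + 3 * weightMoment g 1 * (∫ u, u ^ 2 ∂μ) -
          weightMoment g 0 * (∫ u, u ^ 3 ∂μ))) := by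
  have := hμ.prob
  have hfree : freeGenerator η g (fun w => w ^ 2) = fun u => -2 * η *
      (2 * weightMoment g 1 * u ^ 2 - weightMoment g 0 * u ^ 3 -
        η / 2 * (weightMoment g 3 + 3 * weightMoment g 1 * u ^ 2 - weightMoment g 0 * u ^ 3)) := by
    ext u
    rw [G.freeGenerator_pow]
    simp only [Finset.sum_range_succ, Finset.sum_range_zero, G.relativeMoment_two,
      G.relativeMoment_three, hQ₂]
    norm_num
    ring
  rw [hfree, integral_const_mul, integral_sub, integral_sub, integral_const_mul (η / 2),
    integral_sub, integral_add]
  · simp only [integral_const_mul, integral_const, probReal_univ, one_smul]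
  all_goals exact hμ.integrable (by fun_prop)

lemma integral_freeGenerator_cube (hQ₂ : weightMoment g 2 = 0) :
    ∫ u, freeGenerator η g (fun w => w ^ 3) u ∂μ =
      η * (3 * weightMoment g 0 * (∫ u, u ^ 4 ∂μ) - 6 * weightMoment g 1 * (∫ u, u ^ 3 ∂μ) +
        3 * η * (weightMoment g 3 * (∫ u, u ∂μ) + 3 * weightMoment g 1 * (∫ u, u ^ 3 ∂μ) -
          weightMoment g 0 * (∫ u, u ^ 4 ∂μ)) + η ^ 2 * ∫ u, relativeMoment g 4 u ∂μ) := by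
  have hfree : freeGenerator η g (fun w => w ^ 3) = fun u => η *
      (3 * weightMoment g 0 * u ^ 4 - 6 * weightMoment g 1 * u ^ 3 +
        3 * η * (weightMoment g 3 * u + 3 * weightMoment g 1 * u ^ 3 - weightMoment g 0 * u ^ 4) +
        η ^ 2 * relativeMoment g 4 u) := by
    ext u
    rw [G.freeGenerator_pow]
    simp only [Finset.sum_range_succ, Finset.sum_range_zero, G.relativeMoment_two,
      G.relativeMoment_three, hQ₂]
    norm_num [Nat.choose]
    ring
  have hR₄ := G.continuous_relativeMoment 4
  rw [hfree, integral_const_mul, integral_add, integral_add, integral_sub,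
    integral_const_mul (3 * η), integral_sub, integral_add, integral_const_mul (weightMoment g 3)]
  · simp only [integral_const_mul]
  all_goals exact hμ.integrable (by fun_prop)

end IsGeneratorInvariant

lemma IsGeneratorInvariant.integral_pow_le {Vbar η a : ℝ} {g : ℝ → ℝ} {μ : Measure ℝ}
    (hμ : IsGeneratorInvariant Vbar η g μ) (ha : 0 < a) (hη : 0 < η) (k : ℕ) :
    ∫ u, u ^ (2 * k) ∂μ ≤ k.factorial / a ^ k * (∫ u, Real.exp (a / η * u ^ 2) ∂μ) * η ^ k := by
  rw [mul_assoc, mul_comm (∫ _, _ ∂μ), ← mul_assoc, ← integral_const_mul]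
  refine integral_mono (hμ.integrable (by fun_prop)) (hμ.integrable (by fun_prop)) fun u => ?_
  have hexp := Real.pow_div_factorial_le_exp (a / η * u ^ 2) (by positivity) k
  rw [mul_pow, ← pow_mul, div_pow] at hexp
  calc u ^ (2 * k) = k.factorial / a ^ k * η ^ k *
        (a ^ k / η ^ k * u ^ (2 * k) / k.factorial) := by field_simp
    _ ≤ _ := mul_le_mul_of_nonneg_left hexp (by positivity)

/-! ### Moment asymptotics -/

section Asymptotics

open Asymptotics

variable {ι : Type*} {l : Filter ι} {η : ι → ℝ}

lemma isBigO_exp_neg_div {c : ℝ} (hc : 0 < c) (hη : ∀ᶠ i in l, 0 < η i) :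
    (fun i => Real.exp (-c / η i)) =O[l] fun i => η i ^ 2 := by
  refine .of_bound (2 / c ^ 2) (hη.mono fun i hi => ?_)
  have hexp := Real.pow_div_factorial_le_exp (c / η i) (by positivity) 2
  rw [Real.norm_of_nonneg (Real.exp_pos _).le, Real.norm_of_nonneg (by positivity), neg_div,
    Real.exp_neg]
  refine (inv_anti₀ (by positivity) hexp).trans_eq ?_
  rw [Nat.factorial_two, Nat.cast_two]
  field_simp

variable {vmin vmax Vbar a : ℝ} {g : ℝ → ℝ} {μ : ι → Measure ℝ}
  (hμ : ∀ᶠ i in l, IsGeneratorInvariant Vbar (η i) g (μ i))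
  (H : ∀ᶠ i in l, IsHeavy vmin vmax Vbar (η i))
  (G : IsCollisionWeight vmin vmax g)
  (La : IsLyapunovExponent vmax Vbar g a)
  (hQ₂ : weightMoment g 2 = 0)

include H in
lemma isBigO_sq_self : (fun i => η i ^ 2) =O[l] η := by
  refine .of_bound 1 (H.mono fun i hi => ?_)
  rw [norm_pow, one_mul, Real.norm_of_nonneg hi.pos.le]
  exact pow_le_of_le_one hi.pos.le hi.le_one two_ne_zero

include H La in
lemma isBigO_exp_sq (hV : 0 < Vbar) :
    (fun i => Real.exp (-(a * Vbar ^ 2 / 4) / η i)) =O[l] fun i => η i ^ 2 :=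
  isBigO_exp_neg_div (div_pos (mul_pos La.pos (pow_pos hV 2)) four_pos)
    (H.mono fun _ hi => hi.pos)

include hμ G in
lemma isBigO_integral_relativeMoment (j : ℕ) :
    (fun i => ∫ u, relativeMoment g j u ∂μ i) =O[l] fun _ => (1 : ℝ) := by
  refine .of_bound ((∫ v, |g v|) * (vmax + Vbar) ^ j) (hμ.mono fun i hi => ?_)
  have := hi.prob
  simpa using norm_integral_le_of_norm_le_const (f := relativeMoment g j)
    (hi.support.mono fun u hu => G.abs_relativeMoment_le j hu)

include hμ H G La hQ₂

lemma isBigO_integral_exp :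
    (fun i => ∫ u, Real.exp (a / η i * u ^ 2) ∂μ i) =O[l] fun _ => (1 : ℝ) := by
  refine .of_bound (2 * Real.exp (a * (2 * (∫ v, |g v|) * (vmax + Vbar) ^ 3) / weightMoment g 1))
    ((hμ.and H).mono fun i hi => ?_)
  rw [Real.norm_of_nonneg (integral_nonneg fun u => (Real.exp_pos _).le), norm_one, mul_one]
  exact hi.1.integral_exp_le La G hi.2 hQ₂

lemma isBigO_integral_pow (k : ℕ) :
    (fun i => ∫ u, u ^ (2 * k) ∂μ i) =O[l] fun i => η i ^ k := by
  refine IsBigO.trans (g := fun i => (∫ u, Real.exp (a / η i * u ^ 2) ∂μ i) * η i ^ k)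
    (.of_bound (k.factorial / a ^ k) ((hμ.and H).mono fun i hi => ?_)) ?_
  · have hη := hi.2.pos
    rw [Real.norm_of_nonneg (integral_nonneg fun u => (even_two_mul k).pow_nonneg u),
      Real.norm_of_nonneg (mul_nonneg (integral_nonneg fun u => (Real.exp_pos _).le)
        (by positivity)), ← mul_assoc]
    exact hi.1.integral_pow_le La.pos hη k
  · simpa using (isBigO_integral_exp hμ H G La hQ₂).mul (isBigO_refl (fun i => η i ^ k) l)

lemma isBigO_integral_cube : (fun i => ∫ u, u ^ 3 ∂μ i) =O[l] η := by
  refine IsBigO.trans (g := fun i => ∫ u, u ^ 2 ∂μ i)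
    (.of_bound Vbar (hμ.mono fun i hi => ?_)) ?_
  · rw [Real.norm_of_nonneg (integral_nonneg fun u => sq_nonneg u), ← integral_const_mul]
    refine norm_integral_le_of_norm_le (hi.integrable (by fun_prop))
      (hi.support.mono fun u hu => ?_)
    rw [Real.norm_eq_abs, abs_pow, pow_succ', sq_abs]
    exact mul_le_mul_of_nonneg_right hu (sq_nonneg u)
  · simpa using isBigO_integral_pow hμ H G La hQ₂ 1

lemma isBigO_integral_freeGenerator {f : ℝ → ℝ} (hf : ContDiff ℝ 1 f) :
    (fun i => (η i)⁻¹ * ∫ u, freeGenerator (η i) g f u ∂μ i) =O[l]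
      fun i => Real.exp (-(a * Vbar ^ 2 / 4) / η i) := by
  obtain ⟨L, hL⟩ := hf.locallyLipschitz.locallyLipschitzOn.exists_lipschitzOnWith_of_compact
    (isCompact_Icc (a := -(2 * Vbar)) (b := 2 * Vbar))
  refine IsBigO.trans (g := fun i => (∫ u, Real.exp (a / η i * u ^ 2) ∂μ i) *
    Real.exp (-(a * Vbar ^ 2 / 4) / η i))
    (.of_bound (2 * (∫ v, |g v|) * (vmax + Vbar) ^ 2 * L) ((hμ.and H).mono fun i hi => ?_)) ?_
  · have hη := hi.2.pos
    have hle := hi.1.abs_integral_freeGenerator_le G hi.2 hf.continuous hL La.pos.le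
    rw [norm_mul, norm_inv, Real.norm_of_nonneg hη.le, inv_mul_le_iff₀ hη,
      Real.norm_of_nonneg (mul_nonneg (integral_nonneg fun u => (Real.exp_pos _).le)
        (Real.exp_pos _).le)]
    exact hle.trans_eq (by ring)
  · simpa using (isBigO_integral_exp hμ H G La hQ₂).mul
      (isBigO_refl (fun i => Real.exp (-(a * Vbar ^ 2 / 4) / η i)) l)

theorem isBigO_first_moment_identity :
    (fun i => weightMoment g 2 - 2 * weightMoment g 1 * (∫ u, u ∂μ i) +
      weightMoment g 0 * (∫ u, u ^ 2 ∂μ i)) =O[l]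
        fun i => Real.exp (-(a * Vbar ^ 2 / 4) / η i) := by
  refine (isBigO_integral_freeGenerator hμ H G La hQ₂ contDiff_id).congr'
    ((hμ.and H).mono fun i hi => ?_) .rfl
  rw [inv_mul_eq_iff_eq_mul₀ hi.2.pos.ne']
  exact hi.1.integral_freeGenerator_id G

theorem isBigO_second_moment_identity :
    (fun i => 2 * weightMoment g 1 * (∫ u, u ^ 2 ∂μ i) - weightMoment g 0 * (∫ u, u ^ 3 ∂μ i) -
      η i / 2 * (weightMoment g 3 + 3 * weightMoment g 1 * (∫ u, u ^ 2 ∂μ i) -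
        weightMoment g 0 * (∫ u, u ^ 3 ∂μ i))) =O[l]
          fun i => Real.exp (-(a * Vbar ^ 2 / 4) / η i) := by
  refine ((isBigO_integral_freeGenerator hμ H G La hQ₂ (contDiff_id.pow 2)).const_mul_left
    (-1 / 2)).congr' ((hμ.and H).mono fun i hi => ?_) .rfl
  have hη := hi.2.pos
  simp only [id_eq, hi.1.integral_freeGenerator_sq G hQ₂]
  field_simp

theorem isBigO_third_moment_identity :
    (fun i => 3 * weightMoment g 0 * (∫ u, u ^ 4 ∂μ i) -
      6 * weightMoment g 1 * (∫ u, u ^ 3 ∂μ i) +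
      3 * η i * (weightMoment g 3 * (∫ u, u ∂μ i) + 3 * weightMoment g 1 * (∫ u, u ^ 3 ∂μ i) -
        weightMoment g 0 * (∫ u, u ^ 4 ∂μ i)) + η i ^ 2 * ∫ u, relativeMoment g 4 u ∂μ i) =O[l]
          fun i => Real.exp (-(a * Vbar ^ 2 / 4) / η i) := by
  refine (isBigO_integral_freeGenerator hμ H G La hQ₂ (contDiff_id.pow 3)).congr'
    ((hμ.and H).mono fun i hi => ?_) .rfl
  rw [inv_mul_eq_iff_eq_mul₀ hi.2.pos.ne']
  exact hi.1.integral_freeGenerator_cube G hQ₂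

variable (hvmin : 0 < vmin) (hV : 0 < Vbar)
include hvmin hV

lemma isBigO_integral_id : (fun i => ∫ u, u ∂μ i) =O[l] η := by
  have hQ₁ := (mul_pos two_pos (G.weightMoment_one_pos hvmin)).ne'
  have hW₂ : (fun i => ∫ u, u ^ 2 ∂μ i) =O[l] η := by
    simpa using isBigO_integral_pow hμ H G La hQ₂ 1
  have hexp := (isBigO_exp_sq H La hV).trans (isBigO_sq_self H)
  refine (isBigO_const_mul_left_iff hQ₁).1
    (((hW₂.const_mul_left (weightMoment g 0)).sub
      ((isBigO_first_moment_identity hμ H G La hQ₂).trans hexp)).congr_left fun i => ?_)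
  rw [hQ₂]
  ring

lemma isBigO_integral_cube_sq : (fun i => ∫ u, u ^ 3 ∂μ i) =O[l] fun i => η i ^ 2 := by
  have hQ₁ := (mul_pos (by norm_num : (0 : ℝ) < 6) (G.weightMoment_one_pos hvmin)).ne'
  have hexp := isBigO_exp_sq H La hV
  have hW₁ := isBigO_integral_id hμ H G La hQ₂ hvmin hV
  have hW₃ := isBigO_integral_cube hμ H G La hQ₂
  have hW₄ : (fun i => ∫ u, u ^ 4 ∂μ i) =O[l] fun i => η i ^ 2 :=
    isBigO_integral_pow hμ H G La hQ₂ 2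
  have hW₄' := hW₄.trans (isBigO_sq_self H)
  have hR₄ := (isBigO_refl (fun i => η i ^ 2) l).mul (isBigO_integral_relativeMoment hμ G 4)
  have hlinear := (isBigO_refl η l).mul (((hW₁.const_mul_left (weightMoment g 3)).add
    (hW₃.const_mul_left (3 * weightMoment g 1))).sub (hW₄'.const_mul_left (weightMoment g 0)))
  simp only [mul_one, ← sq] at hR₄ hlinear
  refine (isBigO_const_mul_left_iff hQ₁).1
    (((((hW₄.const_mul_left (3 * weightMoment g 0)).add (hlinear.const_mul_left 3)).add hR₄).sub
      ((isBigO_third_moment_identity hμ H G La hQ₂).trans hexp)).congr_left fun i => ?_)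
  ring

theorem isBigO_integral_sq_sub :
    (fun i => (∫ u, u ^ 2 ∂μ i) - weightMoment g 3 / (2 * weightMoment g 1) * (η i / 2)) =O[l]
      fun i => η i ^ 2 := by
  have hQ₁ := (G.weightMoment_one_pos hvmin).ne'
  have hexp := isBigO_exp_sq H La hV
  have hW₂ : (fun i => ∫ u, u ^ 2 ∂μ i) =O[l] η := by
    simpa using isBigO_integral_pow hμ H G La hQ₂ 1
  have hlinear := (isBigO_refl η l).mul ((hW₂.const_mul_left (3 * weightMoment g 1)).sub
    ((isBigO_integral_cube hμ H G La hQ₂).const_mul_left (weightMoment g 0)))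
  simp only [← sq] at hlinear
  refine (isBigO_const_mul_left_iff (mul_ne_zero two_ne_zero hQ₁)).1
    (((((isBigO_integral_cube_sq hμ H G La hQ₂ hvmin hV).const_mul_left (weightMoment g 0)).add
      (hlinear.const_mul_left (1 / 2))).add
        ((isBigO_second_moment_identity hμ H G La hQ₂).trans hexp)).congr_left fun i => ?_)
  field_simp
  ring

theorem isBigO_integral_id_sub :
    (fun i => (∫ u, u ∂μ i) -
      weightMoment g 0 * weightMoment g 3 / (4 * weightMoment g 1 ^ 2) * (η i / 2)) =O[l]
        fun i => η i ^ 2 := by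
  have hQ₁ := (G.weightMoment_one_pos hvmin).ne'
  have hexp := isBigO_exp_sq H La hV
  refine (isBigO_const_mul_left_iff (mul_ne_zero two_ne_zero hQ₁)).1
    ((((isBigO_integral_sq_sub hμ H G La hQ₂ hvmin hV).const_mul_left (weightMoment g 0)).sub
      ((isBigO_first_moment_identity hμ H G La hQ₂).trans hexp)).congr_left fun i => ?_)
  rw [hQ₂]
  field_simp
  ring

end Asymptotics

/-! ### From `2 * m / (M + m)` to `m / M` -/

lemma exists_isHeavy_of_div_le {vmin vmax Vbar : ℝ} (hvmin : 0 < vmin) (hvmax : vmin < vmax)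
    (hV : 0 < Vbar) (hV' : Vbar < vmin / 3) :
    ∃ ε₀ > 0, ∀ m M : ℝ, 0 < m → 0 < M → m / M ≤ ε₀ →
      IsHeavy vmin vmax Vbar (2 * m / (M + m)) := by
  have hK : 0 < vmax + Vbar := by linarith
  refine ⟨min (Vbar / (4 * (vmax + Vbar))) ((vmin - 3 * Vbar) / (4 * vmin)),
    lt_min (by positivity) (div_pos (by linarith) (by positivity)), fun m M hm hM hε => ?_⟩
  have hη : 2 * m / (M + m) ≤ 2 * (m / M) := by
    rw [mul_div_assoc]
    gcongr
    linarith
  have hkick := (le_div_iff₀ (by positivity)).1 (hε.trans (min_le_left _ _))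
  have hrecollision := (le_div_iff₀ (by positivity)).1 (hε.trans (min_le_right _ _))
  refine ⟨hvmin, hvmax, hV, by positivity, ?_, ?_⟩
  · linarith [mul_le_mul_of_nonneg_right hη hvmin.le, mul_pos (div_pos hm hM) hvmin]
  · linarith [mul_le_mul_of_nonneg_right hη hK.le]

section MassRatio

open Asymptotics

variable {ι : Type*} {l : Filter ι} {m M : ι → ℝ} (hpos : ∀ᶠ i in l, 0 < m i ∧ 0 < M i)
include hpos

lemma isBigO_two_mul_div_add : (fun i => 2 * m i / (M i + m i)) =O[l] fun i => m i / M i := by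
  refine .of_bound 2 (hpos.mono fun i ⟨hm, hM⟩ => ?_)
  rw [Real.norm_of_nonneg (by positivity), Real.norm_of_nonneg (by positivity), mul_div_assoc]
  gcongr
  linarith

lemma isBigO_div_add_sub_div :
    (fun i => 2 * m i / (M i + m i) / 2 - m i / M i) =O[l] fun i => (m i / M i) ^ 2 := by
  refine .of_bound 1 (hpos.mono fun i ⟨hm, hM⟩ => ?_)
  have hsub : 2 * m i / (M i + m i) / 2 - m i / M i = -(m i ^ 2 / ((M i + m i) * M i)) := by
    field_simp
    ring
  rw [hsub, norm_neg, Real.norm_of_nonneg (by positivity), Real.norm_of_nonneg (by positivity),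
    div_pow, one_mul, sq (M i)]
  gcongr
  linarith

lemma isBigO_exp_neg_div_div {c : ℝ} (hc : 0 ≤ c) :
    (fun i => Real.exp (-c / (2 * m i / (M i + m i)))) =O[l]
      fun i => Real.exp (-(c / 2) / (m i / M i)) := by
  refine .of_bound 1 (hpos.mono fun i ⟨hm, _⟩ => ?_)
  rw [Real.norm_of_nonneg (Real.exp_pos _).le, Real.norm_of_nonneg (Real.exp_pos _).le, one_mul,
    Real.exp_le_exp]
  field_simp
  nlinarith

lemma isBigO_sub_mul_div {X : ι → ℝ} {q : ℝ}
    (hX : (fun i => X i - q * (2 * m i / (M i + m i) / 2)) =O[l]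
      fun i => (2 * m i / (M i + m i)) ^ 2) :
    (fun i => X i - q * (m i / M i)) =O[l] fun i => (m i / M i) ^ 2 := by
  refine ((hX.trans ((isBigO_two_mul_div_add hpos).pow 2)).add
    ((isBigO_div_add_sub_div hpos).const_mul_left q)).congr_left fun i => ?_
  ring

theorem exists_isBigO_moments {vmin vmax Vbar : ℝ} {g : ℝ → ℝ} {μ : ι → Measure ℝ}
    (hμ : ∀ᶠ i in l, IsGeneratorInvariant Vbar (2 * m i / (M i + m i)) g (μ i))
    (H : ∀ᶠ i in l, IsHeavy vmin vmax Vbar (2 * m i / (M i + m i)))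
    (G : IsCollisionWeight vmin vmax g) (hQ₂ : weightMoment g 2 = 0) (hvmin : 0 < vmin)
    (hK : 0 < vmax + Vbar) (hV : 0 < Vbar) :
    ∃ c > 0,
      ((fun i => (∫ u, u ^ 2 ∂μ i) - weightMoment g 3 / (2 * weightMoment g 1) * (m i / M i)) =O[l]
        fun i => (m i / M i) ^ 2) ∧
      ((fun i => (∫ u, u ∂μ i) -
        weightMoment g 0 * weightMoment g 3 / (4 * weightMoment g 1 ^ 2) * (m i / M i)) =O[l]
          fun i => (m i / M i) ^ 2) ∧
      ((fun i => weightMoment g 2 - 2 * weightMoment g 1 * (∫ u, u ∂μ i) +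
        weightMoment g 0 * (∫ u, u ^ 2 ∂μ i)) =O[l] fun i => Real.exp (-c / (m i / M i))) ∧
      (fun i => 2 * weightMoment g 1 * (∫ u, u ^ 2 ∂μ i) - weightMoment g 0 * (∫ u, u ^ 3 ∂μ i) -
        m i / (M i + m i) * (weightMoment g 3 + 3 * weightMoment g 1 * (∫ u, u ^ 2 ∂μ i) -
          weightMoment g 0 * (∫ u, u ^ 3 ∂μ i))) =O[l]
            fun i => Real.exp (-c / (m i / M i)) := by
  obtain ⟨a, La⟩ := G.exists_isLyapunovExponent hvmin hK
  have hc : 0 < a * Vbar ^ 2 / 4 := div_pos (mul_pos La.pos (pow_pos hV 2)) four_pos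
  have hexp := isBigO_exp_neg_div_div hpos hc.le
  refine ⟨a * Vbar ^ 2 / 4 / 2, half_pos hc,
    isBigO_sub_mul_div hpos (isBigO_integral_sq_sub hμ H G La hQ₂ hvmin hV),
    isBigO_sub_mul_div hpos (isBigO_integral_id_sub hμ H G La hQ₂ hvmin hV),
    (isBigO_first_moment_identity hμ H G La hQ₂).trans hexp,
    ((isBigO_second_moment_identity hμ H G La hQ₂).trans hexp).congr_left fun i => ?_⟩
  ring

end MassRatio

end Piston

theorem mainTheorem2 (vmin vmax Vbar : ℝ) (hvmin : 0 < vmin) (hvmax : vmin < vmax)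
    (hV : 0 < Vbar) (hV' : Vbar < vmin / 3) (pminus pplus : ℝ → ℝ)
    (hminus : Piston.IsGasDensity vmin vmax pminus)
    (hplus : Piston.IsGasDensity vmin vmax pplus)
    (Q : ℕ → ℝ) (hQ : Q = Piston.Q vmin vmax pminus pplus) (hQ2 : Q 2 = 0) :
    ∃ C > 0, ∃ c > 0, ∃ ε₀ > 0, ∀ m M ε : ℝ, 0 < m → 0 < M → ε = m / M → ε ≤ ε₀ →
      ∀ μ : MeasureTheory.Measure ℝ, Piston.IsStationary m M Vbar pminus pplus μ →
        |(∫ w, w ^ 2 ∂μ) - Q 3 / (2 * Q 1) * ε| ≤ C * ε ^ 2 ∧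
        |(∫ w, w ∂μ) - Q 0 * Q 3 / (4 * Q 1 ^ 2) * ε| ≤ C * ε ^ 2 ∧
        |Q 2 - 2 * Q 1 * (∫ w, w ∂μ) + Q 0 * (∫ w, w ^ 2 ∂μ)| ≤ C * Real.exp (-c / ε) ∧
        |2 * Q 1 * (∫ w, w ^ 2 ∂μ) - Q 0 * (∫ w, w ^ 3 ∂μ) -
            m / (M + m) * (Q 3 + 3 * Q 1 * (∫ w, w ^ 2 ∂μ) - Q 0 * (∫ w, w ^ 3 ∂μ))|
          ≤ C * Real.exp (-c / ε) := by
  obtain rfl : Q = Piston.weightMoment (Piston.signedDensity pminus pplus) :=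
    hQ.trans (funext (Piston.Q_eq_weightMoment hvmin hvmax hminus hplus))
  obtain ⟨ε₀, hε₀, hheavy⟩ := Piston.exists_isHeavy_of_div_le hvmin hvmax hV hV'
  let S : Set (ℝ × ℝ × Measure ℝ) := {i | (0 < i.1 ∧ 0 < i.2.1) ∧ i.1 / i.2.1 ≤ ε₀ ∧
    Piston.IsStationary i.1 i.2.1 Vbar pminus pplus i.2.2}
  have hS : ∀ i ∈ S, Piston.IsHeavy vmin vmax Vbar (2 * i.1 / (i.2.1 + i.1)) :=
    fun i hi => hheavy _ _ hi.1.1 hi.1.2 hi.2.1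
  obtain ⟨c, hc, hsq, hid, hfirst, hsecond⟩ := Piston.exists_isBigO_moments (l := 𝓟 S)
    (eventually_principal.2 fun i hi => hi.1)
    (eventually_principal.2 fun i hi => hi.2.2.isGeneratorInvariant hminus hplus
      (add_pos hi.1.2 hi.1.1).ne' (hS i hi))
    (eventually_principal.2 hS) (Piston.isCollisionWeight_signedDensity hminus hplus)
    hQ2 hvmin (by linarith) hV
  obtain ⟨C₁, hC₁, hmoments⟩ := (hsq.prod_left hid).exists_pos
  obtain ⟨C₂, -, hidentities⟩ := (hfirst.prod_left hsecond).exists_pos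
  refine ⟨max C₁ C₂, lt_max_of_lt_left hC₁, c, hc, ε₀, hε₀, ?_⟩
  rintro m M _ hm hM rfl hε μ hμ
  have hi : (m, M, μ) ∈ S := ⟨⟨hm, hM⟩, hε, hμ⟩
  have h₁ := eventually_principal.1 (hmoments.weaken (le_max_left C₁ C₂)).bound _ hi
  have h₂ := eventually_principal.1 (hidentities.weaken (le_max_right C₁ C₂)).bound _ hi
  rw [Real.norm_of_nonneg (sq_nonneg _)] at h₁
  rw [Real.norm_of_nonneg (Real.exp_pos _).le] at h₂
  exact ⟨(norm_fst_le _).trans h₁, (norm_snd_le _).trans h₁, (norm_fst_le _).trans h₂,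
    (norm_snd_le _).trans h₂⟩
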